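/- **Model.** Let $n\ge 2$ users hold inputs $x_1,\dots,x_n\in\mathcal X$. A non-interactive mechanism consists of a randomizer $\mathcal R$, which maps each input to a probability distribution on a message space, and an analyst. User $i$ sends a single message drawn from $\mathcal R(x_i)$, independently of the other users (there is no shared randomness), and the analyst computes a real estimate $\hat z$ from the $n$ messages. The mechanism is $\varepsilon$-local-DP if $\Pr[\mathcal R(x)\in S]\le e^{\varepsilon}\Pr[\mathcal R(x')\in S]$ for all $x,x'\in\mathcal X$ and all events $S$. It estimates a statistic $F$ with $\mathrm{MSE}$ at most $\beta$ if $\mathbb E[(\hat z-F(x_1,\dots,x_n))^2]\le\beta$ for every input $(x_1,\dots,x_n)\in\mathcal X^n$ (every admissible input, if an assumption on the input is made). The pairwise statistic with kernel $f:\mathcal X^2\to\mathbb R$ is $\binom n2^{-1}\sum_{i<j}f(x_i,x_j)$. **Statement.** Fix $\varepsilon_0>0$. For all $n\ge2$ and $0<\varepsilon\le\varepsilon_0$ there are non-interactive $\varepsilon$-local-DP mechanisms for the following statistics with the following $\mathrm{MSE}$; the constants hidden in $O(\cdot)$ depend only on $\varepsilon_0$ (and in 3 also on $c$). 1. *Lipschitz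 kernels.* For every symmetric $f:[0,1]^2\to\mathbb R$ with $|f(x,y)-f(x',y)|\le G|x-x'|$ for all $x,x',y$, the pairwise statistic with kernel $f$: $\mathrm{MSE}$ $O\!\left(\frac{G^2\log n}{\varepsilon^2 n}\right)$. 2. *Kendall's $\tau$.* For $\mathcal X=A\times B$ with $A,B\subset\mathbb R$ finite and $k=|\mathcal X|$, the pairwise statistic with kernel $f((y,z),(y',z'))=\mathrm{sgn}(y-y')\,\mathrm{sgn}(z-z')$: $\mathrm{MSE}$ $O\!\left(\frac{(\log k)^5}{\varepsilon^2 n}\right)$. 3. *AUC.* For $\mathcal X=A\times\{0,1\}$ with $A\subset\mathbb R$ finite and $k=|\mathcal X|$, the statistic $\frac1{n^+n^-}\sum_{i<j}\mathrm{sgn}(y_i-y_j)\,\mathrm{sgn}(z_i-z_j)$, where $x_i=(y_i,z_i)$ and $n^+$, $n^-$ are the numbers of $i$ with $z_i=1$, $z_i=0$ (this is $2\,\mathrm{AUC}-1$ if $\mathrm{AUC}$ counts ties with weight $\frac12$). For every constant $c>0$, under the balancedness assumption $n^+,n^-\ge cn$ on the input: $\mathrm{MSE}$ $O\!\left(\frac{(\log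 k)^3}{\varepsilon^2 n}\right)$. 4. *Gini's diversity index.* For finite $\mathcal X\subset\mathbb R$ with $k=|\mathcal X|$, the pairwise statistic with kernel $f(x,x')=\mathbf 1[x\ne x']$: $\mathrm{MSE}$ $O\!\left(\frac{\log k}{\varepsilon^2 n}\right)$. -/

import Mathlib

open MeasureTheory

noncomputable section

/-- A randomizer `R`, sending an input to the law of the message it produces, is `ε`-differentially
private: the laws for any two inputs are within a factor `e ^ ε` of each other on every event. -/
def IsDPRandomizer {𝒳 Y : Type} [MeasurableSpace Y] (ε : ℝ) (R : 𝒳 → Measure Y) : Prop :=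
  ∀ x x' : 𝒳, ∀ S : Set Y, MeasurableSet S →
    R x S ≤ ENNReal.ofReal (Real.exp ε) * R x' S

/-- A non-interactive (private-coin) protocol for `n` users with inputs in `𝒳`. User `i` applies
the randomizer, with fresh independent randomness, to its own input and sends the resulting single
message; the analyst then computes an estimate from the `n` messages. -/
structure NonInteractiveMechanism (𝒳 : Type) (n : ℕ) where
  /-- The space of messages. -/
  Msg : Type
  [measurableSpaceMsg : MeasurableSpace Msg]
  /-- The law of the message sent by a user holding a given input. -/
  randomizer : 𝒳 → Measure Msg
  isProbabilityMeasure_randomizer : ∀ x, IsProbabilityMeasure (randomizer x)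
  /-- The estimate computed by the analyst from the `n` messages. -/
  estimator : (Fin n → Msg) → ℝ
  measurable_estimator : Measurable estimator

attribute [instance] NonInteractiveMechanism.measurableSpaceMsg
  NonInteractiveMechanism.isProbabilityMeasure_randomizer

namespace NonInteractiveMechanism

variable {𝒳 : Type} {n : ℕ}

/-- The mechanism is `ε`-local DP: what each user sends is `ε`-DP in that user's input. -/
def IsLocalDP (M : NonInteractiveMechanism 𝒳 n) (ε : ℝ) : Prop :=
  IsDPRandomizer ε M.randomizer

/-- The law of the `n` messages (mutually independent) when user `i` holds `x i`. -/
def transcript (M : NonInteractiveMechanism 𝒳 n) (x : Fin n → 𝒳) : Measure (Fin n → M.Msg) :=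
  Measure.pi fun i => M.randomizer (x i)

/-- The mean squared error `𝔼[(ẑ - z)²]`, an extended nonnegative real, of the estimate `ẑ`
computed by `M` on the inputs `x`, as an estimate of the real number `z`. -/
def mse (M : NonInteractiveMechanism 𝒳 n) (x : Fin n → 𝒳) (z : ℝ) : ENNReal :=
  ∫⁻ m, ENNReal.ofReal ((M.estimator m - z) ^ 2) ∂(M.transcript x)

end NonInteractiveMechanism

/-- `∑_{i < j} f (x i) (x j)`. -/
def pairSum {𝒳 : Type} {n : ℕ} (f : 𝒳 → 𝒳 → ℝ) (x : Fin n → 𝒳) : ℝ :=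
  ∑ i : Fin n, ∑ j ∈ Finset.univ.filter (fun j : Fin n => i < j), f (x i) (x j)

/-- The pairwise statistic (U-statistic of degree 2) with kernel `f`. -/
def pairwiseStatistic {𝒳 : Type} {n : ℕ} (f : 𝒳 → 𝒳 → ℝ) (x : Fin n → 𝒳) : ℝ :=
  pairSum f x / (n.choose 2 : ℝ)

/-- A kernel on `[0, 1]` that is symmetric and `G`-Lipschitz (in its first argument, hence by
symmetry in each of its arguments). -/
def IsLipschitzKernel (G : ℝ) (f : unitInterval → unitInterval → ℝ) : Prop :=
  (∀ x y, f x y = f y x) ∧ ∀ x x' y, |f x y - f x' y| ≤ G * |(x : ℝ) - (x' : ℝ)|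

/-- The kernel `sgn (y - y') * sgn (z - z')` of Kendall's `τ` coefficient. -/
def kendallKernel (p q : ℝ × ℝ) : ℝ :=
  Real.sign (p.1 - q.1) * Real.sign (p.2 - q.2)

/-- The kernel `𝟙[x ≠ x']` of Gini's diversity index. -/
def giniDiversityKernel (x x' : ℝ) : ℝ :=
  if x ≠ x' then 1 else 0

/-- The number of examples `(score, label)` in the data set `x` whose label is `b`. -/
def labelCount {n : ℕ} (x : Fin n → ℝ × ℝ) (b : ℝ) : ℕ :=
  (Finset.univ.filter fun i : Fin n => (x i).2 = b).card

/-- The AUC statistic of a data set with labels in `{0, 1}`: Kendall's `τ` with the normalization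
`1 / (n⁺ n⁻)` instead of `1 / (n choose 2)`. As pairs with equal labels contribute `0`, it is
the average of `sgn (y - y')` over all pairs of a `1`-labeled score `y` and a `0`-labeled `y'`. -/
def aucStatistic {n : ℕ} (x : Fin n → ℝ × ℝ) : ℝ :=
  pairSum kendallKernel x / ((labelCount x 1 : ℝ) * (labelCount x 0 : ℝ))

end

/-! A kernel on `k` points of the form `f = ∑ w_i φ_i ⊗ ψ_i` with `|φ_i|, |ψ_i| ≤ 1`, `w_i ≥ 0` and
total mass `γ` can be estimated with MSE `O(γ² log k / (ε² n))`, however many terms the sum has.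
Each of the four statistics then needs only a factorization of small mass.

Sparsification (`HasBoundedFactorization.exists_approx`): by Hoeffding's inequality and a union
bound over the `k²` pairs, `γ` times the average of some `d` terms is uniformly within `O(γ √(log k
/ d))` of `f`.

Estimation (`exists_pairwise_estimators`): each user holds the `O(d)` numbers `φ_s(x)`, `ψ_s(x)`,
samples one coordinate and sends a randomized bit for it. The decoded vectors are unbiased, with
second moment `V = O(d / ε²)` in every direction. By `piExp_sq_pairSum_sub_le`, summing their inner
products over pairs `i < j` has variance at most `n³ V d + n² V² d`; after normalization this is
`O(γ² (1 / (ε² n) + d / (ε⁴ n²)))`. The choice `d ≈ ε² n` balances this against the squared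
approximation error.

Factorizations: random signs give the equality kernel mass `1`, hence Gini mass `2`. Comparing
binary digits writes the order sign as `O(log k)` equality kernels times bounded rank-one
differences, so Kendall's kernel has mass `O((log k)²)`. A Lipschitz kernel on a grid telescopes
into threshold functions with mass `2G`. AUC is a quotient of two pairwise statistics, with
numerator of mass `O(log k)` because there are only two labels, and denominator bounded below by
balancedness. -/

noncomputable section

/-! ### Moments of functions of independent messages -/

/-- The expectation of `F m`, where the `m i` are independent with weights `p i`. -/
def piExp {Ω : Type} [Fintype Ω] {n : ℕ} (p : Fin n → Ω → ℝ) (F : (Fin n → Ω) → ℝ) : ℝ :=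
  ∑ m, (∏ i, p i (m i)) * F m

section piExp

variable {Ω : Type} [Fintype Ω] {n : ℕ}

theorem piExp_succ (p : Fin (n + 1) → Ω → ℝ) (F : (Fin (n + 1) → Ω) → ℝ) :
    piExp p F = ∑ a, p 0 a * piExp (Fin.tail p) fun m => F (Fin.cons a m) := by
  unfold piExp
  rw [← (Fin.consEquiv fun _ => Ω).sum_comp, Fintype.sum_prod_type]
  refine Finset.sum_congr rfl fun a _ => ?_
  rw [Finset.mul_sum]
  refine Finset.sum_congr rfl fun m _ => ?_
  simp [Fin.consEquiv, Fin.prod_univ_succ, Fin.tail, mul_assoc]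

/-- Used to condition on all messages except the first. -/
theorem piExp_succ' (p : Fin (n + 1) → Ω → ℝ) (F : (Fin (n + 1) → Ω) → ℝ) :
    piExp p F = piExp (Fin.tail p) fun m => ∑ a, p 0 a * F (Fin.cons a m) := by
  rw [piExp_succ]
  unfold piExp
  simp only [Finset.mul_sum]
  rw [Finset.sum_comm]
  refine Finset.sum_congr rfl fun m _ => Finset.sum_congr rfl fun a _ => ?_
  ring

theorem piExp_zero (p : Fin 0 → Ω → ℝ) (F : (Fin 0 → Ω) → ℝ) : piExp p F = F Fin.elim0 := by
  unfold piExp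
  rw [Fintype.sum_unique]
  simp only [Finset.univ_eq_empty, Finset.prod_empty, one_mul]
  exact congrArg F (Subsingleton.elim _ _)

theorem piExp_add (p : Fin n → Ω → ℝ) (F G : (Fin n → Ω) → ℝ) :
    piExp p (fun m => F m + G m) = piExp p F + piExp p G := by
  simp [piExp, mul_add, Finset.sum_add_distrib]

theorem piExp_const_mul (p : Fin n → Ω → ℝ) (c : ℝ) (F : (Fin n → Ω) → ℝ) :
    piExp p (fun m => c * F m) = c * piExp p F := by
  simp only [piExp, Finset.mul_sum]
  exact Finset.sum_congr rfl fun m _ => by ring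

theorem piExp_sum {ι : Type} (s : Finset ι) (p : Fin n → Ω → ℝ) (F : ι → (Fin n → Ω) → ℝ) :
    piExp p (fun m => ∑ t ∈ s, F t m) = ∑ t ∈ s, piExp p (F t) := by
  simp only [piExp, Finset.mul_sum]
  exact Finset.sum_comm

theorem piExp_mono {p : Fin n → Ω → ℝ} (hp : ∀ i a, 0 ≤ p i a) {F G : (Fin n → Ω) → ℝ}
    (h : ∀ m, F m ≤ G m) : piExp p F ≤ piExp p G :=
  Finset.sum_le_sum fun m _ =>
    mul_le_mul_of_nonneg_left (h m) (Finset.prod_nonneg fun i _ => hp i _)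

theorem piExp_const {p : Fin n → Ω → ℝ} (hp : ∀ i, ∑ a, p i a = 1) (c : ℝ) :
    piExp p (fun _ => c) = c := by
  induction n with
  | zero => exact piExp_zero _ _
  | succ n ih =>
    simp only [piExp_succ, ih (p := Fin.tail p) fun i => hp i.succ]
    rw [← Finset.sum_mul, hp, one_mul]

theorem piExp_sum_apply {p : Fin n → Ω → ℝ} (hp : ∀ i, ∑ a, p i a = 1) (g : Fin n → Ω → ℝ) :
    piExp p (fun m => ∑ j, g j (m j)) = ∑ j, ∑ a, p j a * g j a := by
  induction n with
  | zero => simp [piExp_zero]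
  | succ n ih =>
    rw [piExp_succ]
    have h : ∀ a, piExp (Fin.tail p) (fun m => ∑ j, g j ((Fin.cons a m : Fin (n + 1) → Ω) j)) =
        g 0 a + ∑ j : Fin n, ∑ b, p j.succ b * g j.succ b := fun a => by
      simp only [Fin.sum_univ_succ (n := n), Fin.cons_zero, Fin.cons_succ]
      rw [piExp_add, piExp_const (p := Fin.tail p) fun i => hp i.succ,
        ih (p := Fin.tail p) (fun i => hp i.succ) fun j => g j.succ]
      rfl
    simp only [h, mul_add, Finset.sum_add_distrib, ← Finset.sum_mul, hp, one_mul]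
    rw [Fin.sum_univ_succ]

/-- Second moment of a sum of independent random variables. -/
theorem piExp_sq_sum_apply {p : Fin n → Ω → ℝ} (hp : ∀ i, ∑ a, p i a = 1) (g : Fin n → Ω → ℝ) :
    piExp p (fun m => (∑ j, g j (m j)) ^ 2) =
      (∑ j, ∑ a, p j a * g j a) ^ 2 +
        ∑ j, (∑ a, p j a * g j a ^ 2 - (∑ a, p j a * g j a) ^ 2) := by
  induction n with
  | zero => simp [piExp_zero]
  | succ n ih =>
    rw [piExp_succ]
    set μ := ∑ j : Fin n, ∑ b, p j.succ b * g j.succ b with hμ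
    have h : ∀ a, piExp (Fin.tail p)
        (fun m => (∑ j, g j ((Fin.cons a m : Fin (n + 1) → Ω) j)) ^ 2) =
        g 0 a ^ 2 + 2 * μ * g 0 a + (μ ^ 2 + ∑ j : Fin n,
          (∑ b, p j.succ b * g j.succ b ^ 2 - (∑ b, p j.succ b * g j.succ b) ^ 2)) := fun a => by
      simp only [Fin.sum_univ_succ (n := n), Fin.cons_zero, Fin.cons_succ]
      have e : ∀ m : Fin n → Ω, (g 0 a + ∑ j : Fin n, g j.succ (m j)) ^ 2 =
          g 0 a ^ 2 + (2 * g 0 a * ∑ j : Fin n, g j.succ (m j) +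
            (∑ j : Fin n, g j.succ (m j)) ^ 2) := fun m => by ring
      simp only [e]
      rw [piExp_add, piExp_const (p := Fin.tail p) fun i => hp i.succ, piExp_add, piExp_const_mul,
        piExp_sum_apply (p := Fin.tail p) (fun i => hp i.succ) fun j => g j.succ,
        ih (p := Fin.tail p) (fun i => hp i.succ) fun j => g j.succ]
      simp only [Fin.tail, ← hμ]
      ring
    have e : ∀ a, p 0 a * (2 * μ * g 0 a) = 2 * μ * (p 0 a * g 0 a) := fun a => by ring
    simp only [h, mul_add, Finset.sum_add_distrib, ← Finset.sum_mul, hp, one_mul, e,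
      ← Finset.mul_sum]
    rw [Fin.sum_univ_succ, Fin.sum_univ_succ, ← hμ]
    ring

/-- The squared means are dropped from the variance. -/
theorem piExp_sq_sum_sub_le {p : Fin n → Ω → ℝ} (hp : ∀ i, ∑ a, p i a = 1)
    (g : Fin n → Ω → ℝ) :
    piExp p (fun m => (∑ j, g j (m j) - ∑ j, ∑ a, p j a * g j a) ^ 2) ≤
      ∑ j, ∑ a, p j a * g j a ^ 2 := by
  set μ := ∑ j, ∑ a, p j a * g j a with hμ
  have e : ∀ m : Fin n → Ω, (∑ j, g j (m j) - μ) ^ 2 =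
      (∑ j, g j (m j)) ^ 2 + (-2 * μ * ∑ j, g j (m j) + μ ^ 2) := fun m => by ring
  simp only [e]
  rw [piExp_add, piExp_add, piExp_const_mul, piExp_const hp, piExp_sum_apply hp,
    piExp_sq_sum_apply hp, ← hμ, Finset.sum_sub_distrib]
  have : 0 ≤ ∑ j, (∑ a, p j a * g j a) ^ 2 := Finset.sum_nonneg fun _ _ => sq_nonneg _
  nlinarith

end piExp

/-! ### Algebra of pair sums and pairwise statistics -/

section pairSum

variable {𝒳 : Type} {n : ℕ}

theorem pairSum_succ (f : 𝒳 → 𝒳 → ℝ) (x : Fin (n + 1) → 𝒳) :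
    pairSum f x = ∑ j : Fin n, f (x 0) (x j.succ) + pairSum f (Fin.tail x) := by
  unfold pairSum
  simp only [Finset.sum_filter, Fin.sum_univ_succ (n := n), Fin.tail]
  simp

theorem pairSum_zero (f : 𝒳 → 𝒳 → ℝ) (x : Fin 0 → 𝒳) : pairSum f x = 0 := by
  simp [pairSum]

theorem pairSum_sub (f g : 𝒳 → 𝒳 → ℝ) (x : Fin n → 𝒳) :
    pairSum (fun a b => f a b - g a b) x = pairSum f x - pairSum g x := by
  simp [pairSum, Finset.sum_sub_distrib]

theorem pairSum_const_mul (c : ℝ) (f : 𝒳 → 𝒳 → ℝ) (x : Fin n → 𝒳) :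
    pairSum (fun a b => c * f a b) x = c * pairSum f x := by
  simp [pairSum, Finset.mul_sum]

theorem pairSum_const (c : ℝ) (x : Fin n → 𝒳) :
    pairSum (fun _ _ => c) x = c * (n.choose 2 : ℝ) := by
  induction n with
  | zero => simp [pairSum_zero]
  | succ n ih =>
    rw [pairSum_succ, ih, Nat.choose_succ_succ' n 1]
    simp
    ring

theorem abs_pairSum_le {f g : 𝒳 → 𝒳 → ℝ} {x : Fin n → 𝒳}
    (h : ∀ i j, |f (x i) (x j)| ≤ g (x i) (x j)) : |pairSum f x| ≤ pairSum g x :=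
  (Finset.abs_sum_le_sum_abs _ _).trans <| Finset.sum_le_sum fun i _ =>
    (Finset.abs_sum_le_sum_abs _ _).trans <| Finset.sum_le_sum fun j _ => h i j

theorem abs_pairwiseStatistic_le {f : 𝒳 → 𝒳 → ℝ} {B : ℝ} (x : Fin n → 𝒳) (hn : 2 ≤ n)
    (h : ∀ i j, |f (x i) (x j)| ≤ B) : |pairwiseStatistic f x| ≤ B := by
  have hc : (0 : ℝ) < n.choose 2 := by exact_mod_cast Nat.choose_pos hn
  rw [pairwiseStatistic, abs_div, abs_of_pos hc, div_le_iff₀ hc, ← pairSum_const B x]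
  exact abs_pairSum_le h

theorem pairwiseStatistic_sub (f g : 𝒳 → 𝒳 → ℝ) (x : Fin n → 𝒳) :
    pairwiseStatistic (fun a b => f a b - g a b) x =
      pairwiseStatistic f x - pairwiseStatistic g x := by
  simp [pairwiseStatistic, pairSum_sub, sub_div]

theorem pairwiseStatistic_const (c : ℝ) (x : Fin n → 𝒳) (hn : 2 ≤ n) :
    pairwiseStatistic (fun _ _ => c) x = c := by
  have hc : (0 : ℝ) < n.choose 2 := by exact_mod_cast Nat.choose_pos hn
  rw [pairwiseStatistic, pairSum_const, mul_div_cancel_right₀ _ hc.ne']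

end pairSum

/-! ### Variance of a bilinear pair sum -/

/-- Variance of `∑_{i < j} ⟨α (m i), β (m j)⟩`, when the second moments of `α (m i)` and `β (m j)`
in each direction are at most `V` and the squared norms of their means are at most `D`. -/
theorem piExp_sq_pairSum_sub_le {Ω ι : Type} [Fintype Ω] [Fintype ι] (α β : Ω → ι → ℝ)
    {V D : ℝ} (hV : 0 ≤ V) (hD : 0 ≤ D) {n : ℕ} {p : Fin n → Ω → ℝ}
    (hp0 : ∀ i a, 0 ≤ p i a) (hp : ∀ i, ∑ a, p i a = 1)
    (hα : ∀ i (w : ι → ℝ), ∑ a, p i a * (∑ s, w s * α a s) ^ 2 ≤ V * ∑ s, w s ^ 2)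
    (hβ : ∀ i (w : ι → ℝ), ∑ a, p i a * (∑ s, w s * β a s) ^ 2 ≤ V * ∑ s, w s ^ 2)
    (hu : ∀ i, ∑ s, (∑ a, p i a * α a s) ^ 2 ≤ D)
    (hv : ∀ i, ∑ s, (∑ a, p i a * β a s) ^ 2 ≤ D) :
    piExp p (fun m => (pairSum (fun a b => ∑ s, α a s * β b s) m -
      pairSum (fun P Q => ∑ s, (∑ a, P a * α a s) * (∑ a, Q a * β a s)) p) ^ 2) ≤
      n ^ 3 * (V * D) + n ^ 2 * (V ^ 2 * Fintype.card ι) := by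
  classical
  induction n with
  | zero => simp [piExp_zero, pairSum_zero]
  | succ n ih =>
    -- A single user forms no pair; this case is separate because `1 / n` is used as a weight below.
    rcases Nat.eq_zero_or_pos n with rfl | hn
    · simp [piExp_succ, piExp_zero, pairSum_succ, pairSum_zero]
      positivity
    have hn' : (1 : ℝ) ≤ n := by exact_mod_cast hn
    specialize ih (p := Fin.tail p) (fun i => hp0 i.succ) (fun i => hp i.succ)
      (fun i => hα i.succ) (fun i => hβ i.succ) (fun i => hu i.succ) (fun i => hv i.succ)
    have hq0 : ∀ (i : Fin n) a, 0 ≤ Fin.tail p i a := fun i => hp0 i.succ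
    have hq : ∀ i : Fin n, ∑ a, Fin.tail p i a = 1 := fun i => hp i.succ
    have hβ' : ∀ (i : Fin n) (w : ι → ℝ), ∑ a, Fin.tail p i a * (∑ s, w s * β a s) ^ 2 ≤
      V * ∑ s, w s ^ 2 := fun i => hβ i.succ
    have hv' : ∀ i : Fin n, ∑ s, (∑ a, Fin.tail p i a * β a s) ^ 2 ≤ D := fun i => hv i.succ
    rw [piExp_succ', pairSum_succ _ p]
    change piExp _ (fun m => ∑ a, p 0 a * (_ - (∑ j, ∑ s, (∑ a, p 0 a * α a s) *
      (∑ a, Fin.tail p j a * β a s) + _)) ^ 2) ≤ _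
    simp only [pairSum_succ, Fin.cons_zero, Fin.cons_succ, Fin.tail_cons]
    generalize Fin.tail p = q at *
    have hp00 := hp0 0
    have hp10 := hp 0
    have hα0 := hα 0
    have hu0 := hu 0
    generalize p 0 = p₀ at *
    set u : ι → ℝ := fun s => ∑ a, p₀ a * α a s with hu_def
    set κ := ∑ j, ∑ s, u s * ∑ a, q j a * β a s with hκ
    set X : (Fin n → Ω) → ℝ := fun m => pairSum (fun a b => ∑ s, α a s * β b s) m -
      pairSum (fun P Q => ∑ s, (∑ a, P a * α a s) * ∑ a, Q a * β a s) q with hX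
    set g : Fin n → Ω → ℝ := fun _ a => ∑ s, u s * β a s with hg
    have hκ' : κ = ∑ j, ∑ a, q j a * g j a := by
      simp only [hκ, hg, Finset.mul_sum]
      refine Finset.sum_congr rfl fun j _ => ?_
      rw [Finset.sum_comm]
      exact Finset.sum_congr rfl fun a _ => Finset.sum_congr rfl fun s _ => by ring
    -- The first message is averaged out with the others fixed. `X` is the error of the remaining
    -- users and `κ` the mean of the new cross term. Weighting AM-GM by `1 / n` lets the error grow
    -- only by the factor `1 + 1 / n` per user, and the last summand has mean zero.
    have key : ∀ m : Fin n → Ω, ∑ a, p₀ a * (∑ j, ∑ s, α a s * β (m j) s +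
        pairSum (fun a b => ∑ s, α a s * β b s) m - (κ +
        pairSum (fun P Q => ∑ s, (∑ a, P a * α a s) * ∑ a, Q a * β a s) q)) ^ 2 ≤
        (1 + 1 / n) * X m ^ 2 + (n * (∑ j, g j (m j) - κ) ^ 2 +
          (V * ∑ s, (∑ j, β (m j) s) ^ 2 + -2 * κ * (∑ j, g j (m j) + -κ))) := by
      intro m
      have hA : ∀ a, ∑ j, ∑ s, α a s * β (m j) s = ∑ s, (∑ j, β (m j) s) * α a s := by
        intro a
        rw [Finset.sum_comm]
        simp only [← Finset.mul_sum, mul_comm]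
      have hY : ∑ a, p₀ a * ∑ s, (∑ j, β (m j) s) * α a s = ∑ j, g j (m j) := by
        have : ∀ a, p₀ a * ∑ s, (∑ j, β (m j) s) * α a s =
            ∑ s, (∑ j, β (m j) s) * (p₀ a * α a s) := fun a => by
          rw [Finset.mul_sum]
          exact Finset.sum_congr rfl fun s _ => by ring
        simp only [this, hg]
        rw [Finset.sum_comm, Finset.sum_comm (s := (Finset.univ : Finset (Fin n)))]
        refine Finset.sum_congr rfl fun s _ => ?_
        rw [← Finset.mul_sum, ← Finset.mul_sum, mul_comm]
      have hV2 := hα0 fun s => ∑ j, β (m j) s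
      have e : ∀ a, p₀ a * (∑ j, ∑ s, α a s * β (m j) s +
          pairSum (fun a b => ∑ s, α a s * β b s) m - (κ +
          pairSum (fun P Q => ∑ s, (∑ a, P a * α a s) * ∑ a, Q a * β a s) q)) ^ 2 =
          p₀ a * (∑ s, (∑ j, β (m j) s) * α a s) ^ 2 +
          (2 * (X m - κ) * (p₀ a * ∑ s, (∑ j, β (m j) s) * α a s) +
            p₀ a * (X m - κ) ^ 2) := fun a => by
        rw [hA, hX]
        ring
      simp only [e, Finset.sum_add_distrib, ← Finset.mul_sum, ← Finset.sum_mul, hp10, hY]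
      have hn0 : (0 : ℝ) < n := by linarith
      have amgm : 2 * X m * (∑ j, g j (m j) - κ) ≤
          1 / n * X m ^ 2 + n * (∑ j, g j (m j) - κ) ^ 2 := by
        have h1 : 0 ≤ 1 / n * (X m - n * (∑ j, g j (m j) - κ)) ^ 2 := by positivity
        have h2 : 1 / n * (X m - n * (∑ j, g j (m j) - κ)) ^ 2 =
          1 / n * X m ^ 2 - 2 * X m * (∑ j, g j (m j) - κ) +
            n * (∑ j, g j (m j) - κ) ^ 2 := by
          field_simp
          ring
        linarith
      nlinarith [sq_nonneg κ]
    refine (piExp_mono hq0 key).trans ?_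
    have h1 : piExp q (fun m => (∑ j, g j (m j) - κ) ^ 2) ≤ n * (V * D) := by
      rw [hκ']
      refine (piExp_sq_sum_sub_le hq g).trans ?_
      calc ∑ j, ∑ a, q j a * g j a ^ 2 ≤ ∑ _j : Fin n, V * D :=
            Finset.sum_le_sum fun j _ => (hβ' j u).trans (mul_le_mul_of_nonneg_left hu0 hV)
        _ = n * (V * D) := by simp
    have h2 : piExp q (fun m => ∑ s, (∑ j, β (m j) s) ^ 2) ≤
        n ^ 2 * D + n * (V * Fintype.card ι) := by
      rw [piExp_sum]
      have hs : ∀ s, piExp q (fun m => (∑ j, β (m j) s) ^ 2) ≤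
          n * ∑ j, (∑ a, q j a * β a s) ^ 2 + n * V := by
        intro s
        rw [piExp_sq_sum_apply hq fun _ a => β a s]
        refine add_le_add ?_ ?_
        · simpa using sq_sum_le_card_mul_sum_sq (s := (Finset.univ : Finset (Fin n)))
            (f := fun j => ∑ a, q j a * β a s)
        · calc _ ≤ ∑ _j : Fin n, V := Finset.sum_le_sum fun j _ => by
                -- The second moment bound in a coordinate direction bounds the variance of that
                -- coordinate.
                have := hβ' j (Pi.single s 1)
                simp only [Pi.single_apply, ite_mul, one_mul, zero_mul, ite_pow, one_pow,
                  Finset.sum_ite_eq', Finset.mem_univ, if_true, ne_eq, OfNat.ofNat_ne_zero,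
                  not_false_eq_true, zero_pow, mul_one] at this
                nlinarith [sq_nonneg (∑ a, q j a * β a s)]
            _ = n * V := by simp
      calc _ ≤ ∑ s, (n * ∑ j, (∑ a, q j a * β a s) ^ 2 + n * V) :=
            Finset.sum_le_sum fun s _ => hs s
        _ = n * ∑ j, ∑ s, (∑ a, q j a * β a s) ^ 2 + n * (V * Fintype.card ι) := by
            rw [Finset.sum_add_distrib, ← Finset.mul_sum, Finset.sum_comm]
            simp
            ring
        _ ≤ n * ∑ _j : Fin n, D + n * (V * Fintype.card ι) := by
            gcongr with j
            exact hv' j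
        _ = _ := by
            simp
            ring
    rw [piExp_add, piExp_add, piExp_add, piExp_const_mul, piExp_const_mul, piExp_const_mul,
      piExp_const_mul, piExp_add, piExp_const hq, piExp_sum_apply hq, ← hκ']
    have hn0 : (0 : ℝ) < n := by linarith
    have i1 : (1 + 1 / (n : ℝ)) * piExp q (fun m => X m ^ 2) ≤
        (1 + 1 / (n : ℝ)) * (n ^ 3 * (V * D) + n ^ 2 * (V ^ 2 * Fintype.card ι)) :=
      mul_le_mul_of_nonneg_left ih (by positivity)
    have i2 : (1 + 1 / (n : ℝ)) * (n ^ 3 * (V * D) + n ^ 2 * (V ^ 2 * Fintype.card ι)) =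
        (n ^ 3 + n ^ 2) * (V * D) + (n ^ 2 + n) * (V ^ 2 * Fintype.card ι) := by
      field_simp
    have i3 := mul_le_mul_of_nonneg_left h1 hn0.le
    have i4 := mul_le_mul_of_nonneg_left h2 hV
    have a1 : 0 ≤ V * D := by positivity
    have a2 : 0 ≤ V ^ 2 * (Fintype.card ι : ℝ) := by positivity
    push_cast
    generalize (Fintype.card ι : ℝ) = d at *
    -- The coefficient of `V * D` is `n³ + 3n² ≤ (n + 1)³`, that of `V² * d` is `n² + 2n ≤ (n +
    -- 1)²`.
    nlinarith [mul_nonneg hn0.le a1, mul_nonneg hn0.le a2]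

/-! ### Kernels with a bounded factorization -/

/-- `f` is a sum of products `φ x * ψ y` of functions bounded by `1`, with nonnegative weights of
total mass `γ`. -/
def HasBoundedFactorization {T : Type} (γ : ℝ) (f : T → T → ℝ) : Prop :=
  ∃ (ι : Type) (_ : Fintype ι) (w : ι → ℝ) (φ ψ : ι → T → ℝ),
    (∀ i, 0 ≤ w i) ∧ ∑ i, w i = γ ∧ (∀ i x, |φ i x| ≤ 1) ∧ (∀ i x, |ψ i x| ≤ 1) ∧
      ∀ x y, f x y = ∑ i, w i * (φ i x * ψ i y)

namespace HasBoundedFactorization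

variable {T U : Type} {γ δ : ℝ} {f g : T → T → ℝ}

theorem nonneg (h : HasBoundedFactorization γ f) : 0 ≤ γ := by
  obtain ⟨ι, _, w, φ, ψ, hw, hγ, -⟩ := h
  exact hγ ▸ Finset.sum_nonneg fun i _ => hw i

theorem abs_le (h : HasBoundedFactorization γ f) (x y : T) : |f x y| ≤ γ := by
  obtain ⟨ι, _, w, φ, ψ, hw, hγ, hφ, hψ, hf⟩ := h
  rw [hf, ← hγ]
  refine (Finset.abs_sum_le_sum_abs _ _).trans (Finset.sum_le_sum fun i _ => ?_)
  rw [abs_mul, abs_mul, abs_of_nonneg (hw i)]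
  exact mul_le_of_le_one_right (hw i) (mul_le_one₀ (hφ i x) (abs_nonneg _) (hψ i y))

theorem comp (h : HasBoundedFactorization γ f) (q : U → T) :
    HasBoundedFactorization γ fun x y => f (q x) (q y) := by
  obtain ⟨ι, _, w, φ, ψ, hw, hγ, hφ, hψ, hf⟩ := h
  exact ⟨ι, inferInstance, w, fun i x => φ i (q x), fun i x => ψ i (q x), hw, hγ,
    fun i x => hφ i _, fun i x => hψ i _, fun x y => hf _ _⟩

theorem sum {ι : Type} [Fintype ι] {γ : ι → ℝ} {f : ι → T → T → ℝ}
    (h : ∀ i, HasBoundedFactorization (γ i) (f i)) :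
    HasBoundedFactorization (∑ i, γ i) fun x y => ∑ i, f i x y := by
  choose κ _ w φ ψ hw hγ hφ hψ hf using h
  refine ⟨Σ i, κ i, inferInstance, fun s => w s.1 s.2, fun s => φ s.1 s.2, fun s => ψ s.1 s.2,
    fun s => hw _ _, ?_, fun s => hφ _ _, fun s => hψ _ _, fun x y => ?_⟩
  · rw [Fintype.sum_sigma]
    exact Finset.sum_congr rfl fun i _ => hγ i
  · rw [Fintype.sum_sigma]
    exact Finset.sum_congr rfl fun i _ => hf i x y

theorem add (hf : HasBoundedFactorization γ f) (hg : HasBoundedFactorization δ g) :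
    HasBoundedFactorization (γ + δ) fun x y => f x y + g x y := by
  have := sum (T := T) (γ := fun b : Bool => cond b γ δ) (f := fun b => cond b f g)
    (by rintro (_ | _) <;> assumption)
  simpa using this

theorem mul (hf : HasBoundedFactorization γ f) (hg : HasBoundedFactorization δ g) :
    HasBoundedFactorization (γ * δ) fun x y => f x y * g x y := by
  obtain ⟨ι, _, w, φ, ψ, hw, hγ, hφ, hψ, hf⟩ := hf
  obtain ⟨κ, _, v, φ', ψ', hv, hδ, hφ', hψ', hg⟩ := hg
  refine ⟨ι × κ, inferInstance, fun s => w s.1 * v s.2, fun s x => φ s.1 x * φ' s.2 x,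
    fun s x => ψ s.1 x * ψ' s.2 x, fun s => mul_nonneg (hw _) (hv _), ?_, fun s x => ?_,
    fun s x => ?_, fun x y => ?_⟩
  · rw [← hγ, ← hδ, Finset.sum_mul_sum, Fintype.sum_prod_type]
  · rw [abs_mul]
    exact mul_le_one₀ (hφ _ _) (abs_nonneg _) (hφ' _ _)
  · rw [abs_mul]
    exact mul_le_one₀ (hψ _ _) (abs_nonneg _) (hψ' _ _)
  · beta_reduce
    rw [hf, hg, Finset.sum_mul_sum, Fintype.sum_prod_type]
    exact Finset.sum_congr rfl fun i _ => Finset.sum_congr rfl fun j _ => by ring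

theorem rankOne {φ ψ : T → ℝ} {a b : ℝ} (ha : 0 ≤ a) (hb : 0 ≤ b) (hφ : ∀ x, |φ x| ≤ a)
    (hψ : ∀ x, |ψ x| ≤ b) : HasBoundedFactorization (a * b) fun x y => φ x * ψ y := by
  have key : ∀ {c t : ℝ}, 0 ≤ c → |t| ≤ c → |t / c| ≤ 1 ∧ c * (t / c) = t := by
    intro c t hc ht
    -- If `c = 0` then `t = 0`, and division by zero gives the right value.
    rcases hc.eq_or_lt with rfl | hc
    · simp [abs_nonpos_iff.1 ht]
    · exact ⟨by rwa [abs_div, abs_of_pos hc, div_le_one hc], mul_div_cancel₀ _ hc.ne'⟩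
  refine ⟨Unit, inferInstance, fun _ => a * b, fun _ x => φ x / a, fun _ x => ψ x / b,
    fun _ => mul_nonneg ha hb, by simp, fun _ x => (key ha (hφ x)).1,
    fun _ x => (key hb (hψ x)).1, fun x y => ?_⟩
  have h1 := (key ha (hφ x)).2
  have h2 := (key hb (hψ y)).2
  simp only [Finset.univ_unique, Finset.sum_singleton]
  rw [← h1, ← h2, h1, h2]
  linear_combination (-(b * (ψ y / b))) * h1 - φ x * h2

theorem zero : HasBoundedFactorization 0 fun _ _ : T => (0 : ℝ) := by
  simpa using rankOne (T := T) (φ := fun _ => 0) (ψ := fun _ => 0) le_rfl le_rfl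
    (by simp) (by simp)

theorem mono (hf : HasBoundedFactorization γ f) (h : γ ≤ δ) : HasBoundedFactorization δ f := by
  have := hf.add (rankOne (T := T) (φ := fun _ => 0) (ψ := fun _ => 0) (sub_nonneg.2 h) zero_le_one
    (fun _ => by simpa using h) (by simp))
  simpa using this

theorem const_mul (c : ℝ) (hf : HasBoundedFactorization γ f) :
    HasBoundedFactorization (|c| * γ) fun x y => c * f x y := by
  have := (rankOne (T := T) (φ := fun _ => c) (ψ := fun _ => 1) (abs_nonneg c) zero_le_one
    (by simp) (by simp)).mul hf
  simpa using this

theorem sub (hf : HasBoundedFactorization γ f) (hg : HasBoundedFactorization δ g) :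
    HasBoundedFactorization (γ + δ) fun x y => f x y - g x y := by
  have := hf.add (hg.const_mul (-1))
  simpa [sub_eq_add_neg] using this

/-- For a uniformly random sign function `s` on `U`, the product `s (q x) * s (q y)` has mean `1` if
`q x = q y` and `0` otherwise. The number of terms is exponential, but only the mass matters. -/
theorem eqKernel [Finite U] [DecidableEq U] (q : T → U) :
    HasBoundedFactorization 1 fun x y => if q x = q y then (1 : ℝ) else 0 := by
  have := Fintype.ofFinite U
  have hab : ∀ (u : ℤˣ), |((u : ℤ) : ℝ)| ≤ 1 := fun u => by
    rcases Int.units_eq_one_or u with rfl | rfl <;> simp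
  have hN : (Fintype.card (U → ℤˣ) : ℝ) ≠ 0 := by exact_mod_cast Fintype.card_ne_zero
  refine ⟨U → ℤˣ, inferInstance, fun _ => 1 / Fintype.card (U → ℤˣ),
    fun s x => ((s (q x) : ℤ) : ℝ), fun s x => ((s (q x) : ℤ) : ℝ), fun _ => by positivity, ?_,
    fun s x => hab _, fun s x => hab _, fun x y => ?_⟩
  · rw [Finset.sum_const, Finset.card_univ, nsmul_eq_mul]
    field_simp
  · beta_reduce
    rw [← Finset.mul_sum]
    split_ifs with h
    · have : ∀ s : U → ℤˣ, ((s (q x) : ℤ) : ℝ) * ((s (q y) : ℤ) : ℝ) = 1 := fun s => by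
        rw [h]
        rcases Int.units_eq_one_or (s (q y)) with h | h <;> simp [h]
      simp only [this, Finset.sum_const, Finset.card_univ, nsmul_eq_mul]
      field_simp
    -- Flipping the sign at `q x` alone permutes the sign functions and negates the product.
    · have : ∑ s : U → ℤˣ, ((s (q x) : ℤ) : ℝ) * ((s (q y) : ℤ) : ℝ) =
          -∑ s : U → ℤˣ, ((s (q x) : ℤ) : ℝ) * ((s (q y) : ℤ) : ℝ) := by
        rw [← Finset.sum_neg_distrib,
          ← Equiv.sum_comp (Equiv.mulLeft (Pi.mulSingle (q x) (-1 : ℤˣ)))]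
        refine Finset.sum_congr rfl fun s _ => ?_
        simp [Pi.mulSingle_eq_of_ne (Ne.symm h)]
      rw [show ∑ s : U → ℤˣ, ((s (q x) : ℤ) : ℝ) * ((s (q y) : ℤ) : ℝ) = 0 by linarith, mul_zero]

end HasBoundedFactorization

/-- Either the numbers already differ after the last binary digit is dropped, and this decides their
order, or the last digit decides it. -/
theorem sign_natCast_sub (a b : ℕ) : Real.sign ((a : ℝ) - b) =
    Real.sign (((a / 2 : ℕ) : ℝ) - (b / 2 : ℕ)) +
      (if a / 2 = b / 2 then (1 : ℝ) else 0) * (((a % 2 : ℕ) : ℝ) - (b % 2 : ℕ)) := by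
  have key : ∀ c d : ℕ, Real.sign ((c : ℝ) - d) = if c < d then -1 else if d < c then 1 else 0 := by
    intro c d
    rcases lt_trichotomy c d with h | rfl | h
    · rw [if_pos h, Real.sign_of_neg (sub_neg.2 (by exact_mod_cast h))]
    · simp
    · rw [if_neg h.not_gt, if_pos h, Real.sign_of_pos (sub_pos.2 (by exact_mod_cast h))]
  rw [key, key]
  by_cases h : a / 2 = b / 2
  · rw [h, if_neg (lt_irrefl _), if_neg (lt_irrefl _), if_pos rfl]
    rcases Nat.mod_two_eq_zero_or_one a with ha | ha <;>
      rcases Nat.mod_two_eq_zero_or_one b with hb | hb <;> rw [ha, hb]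
    · rw [if_neg (by omega), if_neg (by omega)]; simp
    · rw [if_pos (by omega)]; simp
    · rw [if_neg (by omega), if_pos (by omega)]; simp
    · rw [if_neg (by omega), if_neg (by omega)]; simp
  · rw [if_neg h, zero_mul, add_zero]
    rcases lt_or_gt_of_ne h with h | h
    · rw [if_pos h, if_pos (by omega)]
    · rw [if_neg h.not_gt, if_pos h, if_neg (by omega), if_pos (by omega)]

namespace HasBoundedFactorization

variable {T : Type}

/-- Each binary digit costs mass `2`: an equality kernel of mass `1` times a difference of two
rank-one kernels of mass `1`. -/
theorem signKernel_nat (L : ℕ) {r : T → ℕ} (hr : ∀ x, r x < 2 ^ L) :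
    HasBoundedFactorization (2 * L) fun x y => Real.sign ((r x : ℝ) - r y) := by
  induction L generalizing r with
  | zero =>
    have : ∀ x, r x = 0 := fun x => by simpa using hr x
    simpa [this] using zero (T := T)
  | succ L ih =>
    have h1 := ih (r := fun x => r x / 2) fun x => by
      have := hr x
      rw [pow_succ] at this
      show r x / 2 < 2 ^ L
      omega
    have h2 := eqKernel (T := T) fun x => (⟨r x / 2, by
      have := hr x
      rw [pow_succ] at this
      omega⟩ : Fin (2 ^ L))
    have hb : ∀ x, |((r x % 2 : ℕ) : ℝ)| ≤ 1 := fun x => by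
      rcases Nat.mod_two_eq_zero_or_one (r x) with h | h <;> rw [h] <;> simp
    have h3 := (rankOne (ψ := fun _ : T => 1) zero_le_one zero_le_one hb (by simp)).sub
      (rankOne (φ := fun _ : T => 1) zero_le_one zero_le_one (by simp) hb)
    have h4 := h1.add (h2.mul h3)
    simp only [Fin.mk.injEq, mul_one, one_mul, ← sign_natCast_sub] at h4
    convert h4 using 1
    push_cast
    ring

/-- Replacing a point by its rank in `A` preserves order and leaves `⌈log₂ |A|⌉` binary digits. -/
theorem signKernel (A : Finset ℝ) :
    HasBoundedFactorization (6 * Real.log A.card) fun x y : A => Real.sign ((x : ℝ) - y) := by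
  classical
  rcases A.eq_empty_or_nonempty with rfl | hA
  · have := zero (T := (∅ : Finset ℝ))
    convert this using 1
    · simp
    · ext x
      exact absurd x.2 (Finset.notMem_empty _)
  have hlt : ∀ x ∈ A, (A.filter (· < x)).card < A.card := fun x hx =>
    Finset.card_lt_card (Finset.filter_ssubset.2 ⟨x, hx, lt_irrefl x⟩)
  have hmono : ∀ x y : A, x < y → (A.filter (· < (x : ℝ))).card < (A.filter (· < (y : ℝ))).card :=
    fun x y h => Finset.card_lt_card <| by
      refine Finset.ssubset_iff_subset_ne.2 ⟨fun z hz => ?_, fun he => ?_⟩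
      · rw [Finset.mem_filter] at hz ⊢
        exact ⟨hz.1, hz.2.trans h⟩
      · have : (x : ℝ) ∈ A.filter (· < (y : ℝ)) := Finset.mem_filter.2 ⟨x.2, h⟩
        rw [← he] at this
        exact lt_irrefl _ (Finset.mem_filter.1 this).2
  have h := signKernel_nat (T := A) (Nat.clog 2 A.card) (r := fun x => (A.filter (· < (x : ℝ))).card)
    fun x => (hlt x x.2).trans_le (Nat.le_pow_clog one_lt_two _)
  have e : (fun x y : A => Real.sign (((A.filter (· < (x : ℝ))).card : ℝ) -
      (A.filter (· < (y : ℝ))).card)) = fun x y : A => Real.sign ((x : ℝ) - y) := by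
    ext x y
    rcases lt_trichotomy x y with h | rfl | h
    · rw [Real.sign_of_neg (sub_neg.2 (by exact_mod_cast hmono x y h)),
        Real.sign_of_neg (sub_neg.2 (by exact_mod_cast h))]
    · simp
    · rw [Real.sign_of_pos (sub_pos.2 (by exact_mod_cast hmono y x h)),
        Real.sign_of_pos (sub_pos.2 (by exact_mod_cast h))]
  rw [e] at h
  refine h.mono ?_
  -- For `|A| ≥ 2`, `⌈log₂ |A|⌉ ≤ 1 + log |A| / log 2 ≤ 2 log |A| / log 2`, and `4 / log 2 < 6`. For
  -- `|A| ≤ 1` there are no digits.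
  rcases Nat.lt_or_ge 1 A.card with h2 | h2
  · have h3 := Nat.pow_pred_clog_lt_self one_lt_two h2
    have h4 : 1 ≤ Nat.clog 2 A.card := Nat.clog_pos one_lt_two h2
    obtain ⟨m, hm⟩ := Nat.exists_eq_add_of_le' h4
    rw [hm] at h3 ⊢
    have h5 : ((2 : ℝ) ^ m) ≤ A.card := by exact_mod_cast h3.le
    have h6 := Real.log_le_log (by positivity) h5
    rw [Real.log_pow] at h6
    have h7 : Real.log 2 ≤ Real.log A.card :=
      Real.log_le_log two_pos (by exact_mod_cast h2)
    have h8 := Real.log_two_gt_d9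
    push_cast
    nlinarith [(Nat.cast_nonneg m : (0 : ℝ) ≤ m)]
  · rw [Nat.clog_of_right_le_one h2]
    simp only [Nat.cast_zero, mul_zero]
    exact mul_nonneg (by norm_num) (Real.log_natCast_nonneg _)

theorem kendallKernel (A B : Finset ℝ) :
    HasBoundedFactorization (36 * (Real.log A.card * Real.log B.card))
      fun x y : ↥(A ×ˢ B) => kendallKernel (x : ℝ × ℝ) y := by
  have h1 := (signKernel A).comp fun x : ↥(A ×ˢ B) => (⟨x.1.1, (Finset.mem_product.1 x.2).1⟩ : A)
  have h2 := (signKernel B).comp fun x : ↥(A ×ˢ B) => (⟨x.1.2, (Finset.mem_product.1 x.2).2⟩ : B)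
  refine (h1.mul h2).mono (le_of_eq ?_)
  ring

theorem neKernel {U : Type} [Finite U] [DecidableEq U] (q : T → U) :
    HasBoundedFactorization 2 fun x y => if q x ≠ q y then (1 : ℝ) else 0 := by
  have := (rankOne (φ := fun _ : T => 1) (ψ := fun _ : T => 1) zero_le_one zero_le_one
    (by simp) (by simp)).sub (eqKernel q)
  convert this using 1
  · norm_num
  · ext x y
    by_cases h : q x = q y <;> simp [h]

/-- Discretization of a kernel that is Lipschitz in its first argument. -/
theorem gridKernel {n : ℕ} {G : ℝ} (hG : 0 ≤ G) {F : ℕ → ℕ → ℝ}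
    (h0 : ∀ j ≤ n, |F 0 j| ≤ G) (hF : ∀ i < n, ∀ j ≤ n, |F (i + 1) j - F i j| ≤ G / n) :
    HasBoundedFactorization (2 * G) fun i j : Fin (n + 1) => F i j := by
  have h1 := rankOne (T := Fin (n + 1)) (φ := fun _ => 1) (ψ := fun j => F 0 j) zero_le_one hG
    (by simp) fun j => h0 j (Nat.lt_succ_iff.1 j.2)
  -- Telescoping in the first argument: `n` thresholds, each multiplied by an increment of size at
  -- most `G / n`.
  have h2 := sum (T := Fin (n + 1)) (ι := Fin n) fun t =>
    rankOne (T := Fin (n + 1)) (φ := fun i => if (t : ℕ) < i then 1 else 0)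
      (ψ := fun j => F (t + 1) j - F t j) zero_le_one (div_nonneg hG (Nat.cast_nonneg n))
      (fun i => by split_ifs <;> simp) fun j => hF t t.2 j (Nat.lt_succ_iff.1 j.2)
  have h3 := h1.add h2
  have e : (fun x y : Fin (n + 1) => 1 * F 0 y + ∑ t : Fin n, (if (t : ℕ) < x then 1 else 0) *
      (F (t + 1) y - F t y)) = fun i j : Fin (n + 1) => F i j := by
    ext x y
    rw [Fin.sum_univ_eq_sum_range (fun t => (if t < (x : ℕ) then (1 : ℝ) else 0) *
      (F (t + 1) y - F t y)) n]
    simp only [ite_mul, one_mul, zero_mul]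
    rw [← Finset.sum_filter]
    have : (Finset.range n).filter (· < (x : ℕ)) = Finset.range x := by
      ext t
      have := x.2
      simp only [Finset.mem_filter, Finset.mem_range]
      omega
    rw [this, Finset.sum_range_sub (fun t => F t y)]
    ring
  rw [e] at h3
  refine h3.mono ?_
  rcases Nat.eq_zero_or_pos n with rfl | hn
  · simp
    linarith
  · have : (0 : ℝ) < n := by exact_mod_cast hn
    simp only [Finset.sum_const, Finset.card_univ, Fintype.card_fin, nsmul_eq_mul]
    field_simp
    linarith

end HasBoundedFactorization

/-! ### Sparsification of a bounded factorization -/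

/-- Hoeffding's lemma for finitely supported distributions on `[-2, 2]`. -/
theorem sum_mul_exp_le {ι : Type} [Fintype ι] {w z : ι → ℝ} (hw : ∀ i, 0 ≤ w i)
    (hw1 : ∑ i, w i = 1) (hz : ∀ i, |z i| ≤ 2) (hz0 : ∑ i, w i * z i = 0) (t : ℝ) :
    ∑ i, w i * Real.exp (t * z i) ≤ Real.exp (2 * t ^ 2) := by
  have h : ∀ i, w i * Real.exp (t * z i) ≤
      w i * Real.cosh (2 * t) + (Real.sinh (2 * t) / 2) * (w i * z i) := by
    intro i
    have h1 := abs_le.1 (hz i)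
    have h2 := convexOn_exp.2 (Set.mem_univ (2 * t)) (Set.mem_univ (-(2 * t)))
      (show 0 ≤ (2 + z i) / 4 by linarith) (show 0 ≤ (2 - z i) / 4 by linarith) (by ring)
    simp only [smul_eq_mul] at h2
    have e : (2 + z i) / 4 * (2 * t) + (2 - z i) / 4 * -(2 * t) = t * z i := by ring
    rw [e] at h2
    have h3 := mul_le_mul_of_nonneg_left h2 (hw i)
    rw [Real.cosh_eq, Real.sinh_eq]
    linarith
  refine (Finset.sum_le_sum fun i _ => h i).trans ?_
  rw [Finset.sum_add_distrib, ← Finset.sum_mul, ← Finset.mul_sum, hw1, hz0, one_mul, mul_zero,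
    add_zero]
  refine (Real.cosh_le_exp_half_sq _).trans (le_of_eq ?_)
  congr 1
  ring

/-- Method of conditional expectations: by Hoeffding's lemma one more random draw multiplies the
expected potential by at most `exp (2 t²)`, so some draw does no worse. Using both signs of `t`
controls the absolute value of every column sum at once. -/
theorem exists_sum_exp_le {ι κ : Type} [Fintype ι] [Fintype κ] {w : ι → ℝ} {z : ι → κ → ℝ}
    (hw : ∀ i, 0 ≤ w i) (hw1 : ∑ i, w i = 1) (hz : ∀ i c, |z i c| ≤ 2)
    (hz0 : ∀ c, ∑ i, w i * z i c = 0) (t : ℝ) (d : ℕ) :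
    ∃ s : Fin d → ι, ∑ c, (Real.exp (t * ∑ k, z (s k) c) + Real.exp (-t * ∑ k, z (s k) c)) ≤
      2 * Fintype.card κ * Real.exp (2 * t ^ 2) ^ d := by
  induction d with
  | zero =>
    refine ⟨Fin.elim0, ?_⟩
    simp
    linarith
  | succ d ih =>
    obtain ⟨s, hs⟩ := ih
    have havg : ∀ S : κ → ℝ, (∑ c, (Real.exp (t * S c) + Real.exp (-t * S c)) ≤
        2 * Fintype.card κ * Real.exp (2 * t ^ 2) ^ d) →
        ∑ i, w i * ∑ c, (Real.exp (t * (z i c + S c)) +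
        Real.exp (-t * (z i c + S c))) ≤
        2 * Fintype.card κ * Real.exp (2 * t ^ 2) ^ (d + 1) := by
      intro S hs
      calc _ = ∑ c, (Real.exp (t * S c) * ∑ i, w i * Real.exp (t * z i c) +
            Real.exp (-t * S c) * ∑ i, w i * Real.exp (-t * z i c)) := by
            simp only [Finset.mul_sum, ← Finset.sum_add_distrib]
            rw [Finset.sum_comm]
            refine Finset.sum_congr rfl fun c _ => Finset.sum_congr rfl fun i _ => ?_
            rw [mul_add t, mul_add (-t), Real.exp_add, Real.exp_add]
            ring
        _ ≤ ∑ c, (Real.exp (t * S c) * Real.exp (2 * t ^ 2) +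
            Real.exp (-t * S c) * Real.exp (2 * t ^ 2)) := by
            refine Finset.sum_le_sum fun c _ => add_le_add
              (mul_le_mul_of_nonneg_left ?_ (Real.exp_pos _).le)
              (mul_le_mul_of_nonneg_left ?_ (Real.exp_pos _).le)
            · exact sum_mul_exp_le hw hw1 (fun i => hz i c) (hz0 c) t
            · simpa using sum_mul_exp_le hw hw1 (fun i => hz i c) (hz0 c) (-t)
        _ ≤ _ := by
            simp only [← add_mul]
            rw [← Finset.sum_mul, pow_succ (Real.exp _), ← mul_assoc]
            exact mul_le_mul_of_nonneg_right hs (Real.exp_pos _).le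
    by_contra! hcon
    have hlt : ∀ i, 2 * Fintype.card κ * Real.exp (2 * t ^ 2) ^ (d + 1) <
        ∑ c, (Real.exp (t * (z i c + ∑ k, z (s k) c)) +
          Real.exp (-t * (z i c + ∑ k, z (s k) c))) := fun i => by
      simpa only [Fin.sum_univ_succ (n := d), Fin.cons_zero, Fin.cons_succ] using
        hcon (Fin.cons i s)
    obtain ⟨i, -, hi⟩ : ∃ i ∈ Finset.univ, 0 < w i := by
      by_contra! h
      have := Finset.sum_nonpos h
      linarith
    have : ∑ i, w i * (2 * Fintype.card κ * Real.exp (2 * t ^ 2) ^ (d + 1)) <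
        ∑ i, w i * ∑ c, (Real.exp (t * (z i c + ∑ k, z (s k) c)) +
          Real.exp (-t * (z i c + ∑ k, z (s k) c))) :=
      Finset.sum_lt_sum (fun i _ => mul_le_mul_of_nonneg_left (hlt i).le (hw i))
        ⟨i, Finset.mem_univ i, mul_lt_mul_of_pos_left (hlt i) hi⟩
    rw [← Finset.sum_mul, hw1, one_mul] at this
    linarith [havg _ hs]

/-- A bounded factorization is approximated by the average of `d` of its terms. -/
theorem HasBoundedFactorization.exists_approx {T : Type} [Fintype T] {γ : ℝ} {f : T → T → ℝ}
    (h : HasBoundedFactorization γ f) (hT : 2 ≤ Fintype.card T) {d : ℕ} (hd : 0 < d) :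
    ∃ a b : Fin d → T → ℝ, (∀ s x, |a s x| ≤ 1) ∧ (∀ s x, |b s x| ≤ 1) ∧
      ∀ x y, (γ / d * ∑ s, a s x * b s y - f x y) ^ 2 ≤
        27 * (γ ^ 2 * Real.log (Fintype.card T) / d) := by
  have hd' : (0 : ℝ) < d := by exact_mod_cast hd
  -- Mass zero forces `f = 0`; otherwise the weights `w / γ` form a probability distribution.
  rcases h.nonneg.eq_or_lt with rfl | hγ
  · refine ⟨fun _ _ => 0, fun _ _ => 0, by simp, by simp, fun x y => ?_⟩
    have := h.abs_le x y
    simp [abs_nonpos_iff.1 this]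
  have habs := h.abs_le
  obtain ⟨ι, _, w, φ, ψ, hw, hw1, hφ, hψ, hf⟩ := h
  have hk2 : (2 : ℝ) ≤ Fintype.card T := by exact_mod_cast hT
  set k : ℝ := (Fintype.card T : ℝ) with hk
  have hlog : 0 < Real.log k := Real.log_pos (by linarith)
  -- With this `t` the potential is at most `2 k² exp (6 log k) ≤ exp (9 log k)`. Hence `|t S| ≤ 9
  -- log k`, that is `S² ≤ 27 d log k`, the source of the constant.
  set t := Real.sqrt (3 * Real.log k / d)
  have ht : 0 < t := Real.sqrt_pos.2 (by positivity)
  have ht2 : t ^ 2 * d = 3 * Real.log k := by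
    rw [Real.sq_sqrt (by positivity)]
    field_simp
  have hfγ : ∀ x y, |f x y / γ| ≤ 1 := fun x y => by
    rw [abs_div, abs_of_pos hγ, div_le_one hγ]
    exact habs x y
  obtain ⟨s, hs⟩ := exists_sum_exp_le (ι := ι) (κ := T × T) (w := fun i => w i / γ)
    (z := fun i c => φ i c.1 * ψ i c.2 - f c.1 c.2 / γ) (fun i => div_nonneg (hw i) hγ.le)
    (by rw [← Finset.sum_div, hw1, div_self hγ.ne'])
    (fun i c => by
      have : |φ i c.1 * ψ i c.2| ≤ 1 := by
        rw [abs_mul]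
        exact mul_le_one₀ (hφ _ _) (abs_nonneg _) (hψ _ _)
      have := abs_sub (φ i c.1 * ψ i c.2) (f c.1 c.2 / γ)
      have := hfγ c.1 c.2
      linarith)
    (fun c => by
      have : ∀ i, w i / γ * (φ i c.1 * ψ i c.2 - f c.1 c.2 / γ) =
        w i * (φ i c.1 * ψ i c.2) / γ - w i * (f c.1 c.2 / γ / γ) := fun i => by ring
      simp only [this]
      rw [Finset.sum_sub_distrib, ← Finset.sum_div, ← hf, ← Finset.sum_mul, hw1]
      field_simp
      ring)
    t d
  refine ⟨fun j => φ (s j), fun j => ψ (s j), fun j => hφ _, fun j => hψ _, fun x y => ?_⟩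
  set S := ∑ j, (φ (s j) x * ψ (s j) y - f x y / γ) with hS
  have hbound : ∀ u, Real.exp u ≤ 2 * (Fintype.card (T × T) : ℝ) * Real.exp (2 * t ^ 2) ^ d →
      u ≤ 9 * Real.log k := by
    intro u hu
    rw [← Real.exp_nat_mul, Fintype.card_prod, Nat.cast_mul] at hu
    have h1 : 2 * (k * k) ≤ Real.exp (3 * Real.log k) := by
      rw [show (3 : ℝ) * Real.log k = (3 : ℕ) * Real.log k by norm_num, Real.exp_nat_mul,
        Real.exp_log (by linarith)]
      nlinarith [mul_nonneg (sub_nonneg.2 hk2) (mul_self_nonneg k)]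
    have h2 := hu.trans (mul_le_mul_of_nonneg_right h1 (Real.exp_pos _).le)
    rw [← Real.exp_add, Real.exp_le_exp] at h2
    linarith
  have hle : Real.exp (t * S) + Real.exp (-t * S) ≤
      2 * (Fintype.card (T × T) : ℝ) * Real.exp (2 * t ^ 2) ^ d :=
    (Finset.single_le_sum (f := fun c : T × T =>
      Real.exp (t * ∑ j, (φ (s j) c.1 * ψ (s j) c.2 - f c.1 c.2 / γ)) +
      Real.exp (-t * ∑ j, (φ (s j) c.1 * ψ (s j) c.2 - f c.1 c.2 / γ)))
      (fun c _ => by positivity) (Finset.mem_univ (x, y))).trans hs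
  have h1 := hbound (t * S) (by linarith [Real.exp_pos (-t * S)])
  have h2 := hbound (-t * S) (by linarith [Real.exp_pos (t * S)])
  have h3 : (t * S) ^ 2 ≤ (9 * Real.log k) ^ 2 := sq_le_sq' (by linarith) h1
  have h4 : S ^ 2 ≤ 27 * Real.log k * d := by
    have : t ^ 2 * d * S ^ 2 ≤ 81 * Real.log k ^ 2 * d := by nlinarith
    rw [ht2] at this
    have : 3 * Real.log k * (S ^ 2) ≤ 3 * Real.log k * (27 * Real.log k * d) := by linarith
    exact le_of_mul_le_mul_left this (by positivity)
  have e : γ / d * ∑ j, φ (s j) x * ψ (s j) y - f x y = γ / d * S := by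
    rw [hS, Finset.sum_sub_distrib]
    simp only [Finset.sum_const, Finset.card_univ, Fintype.card_fin, nsmul_eq_mul]
    field_simp
  rw [e, mul_pow, div_pow]
  calc γ ^ 2 / d ^ 2 * S ^ 2 ≤ γ ^ 2 / d ^ 2 * (27 * Real.log k * d) := by gcongr
    _ = _ := by
      field_simp

/-! ### Randomized response on a sampled coordinate -/

section RandomizedResponse

variable {ι E : Type} [Fintype ι] [Fintype E]

/-- The sign encoded by a bit. -/
def bitSign (b : Bool) : ℝ := if b then 1 else -1

/-- The weights of the message `(i, b)`, where `i` is a uniformly random coordinate and `b` is a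
randomized response to `a i ∈ [-1, 1]`. -/
def randomizedResponse (θ : ℝ) (a : ι → ℝ) (m : ι × Bool) : ℝ :=
  (1 + bitSign m.2 * (θ * a m.1)) / (2 * Fintype.card ι)

theorem randomizedResponse_bounds {θ : ℝ} (hθ : 0 ≤ θ) {a : ι → ℝ} (ha : ∀ i, |a i| ≤ 1)
    (m : ι × Bool) :
    (1 - θ) / (2 * Fintype.card ι) ≤ randomizedResponse θ a m ∧
      randomizedResponse θ a m ≤ (1 + θ) / (2 * Fintype.card ι) := by
  have h : |bitSign m.2 * (θ * a m.1)| ≤ θ := by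
    rw [abs_mul, abs_mul, abs_of_nonneg hθ]
    have : |bitSign m.2| = 1 := by cases m.2 <;> simp [bitSign]
    rw [this, one_mul]
    exact mul_le_of_le_one_right hθ (ha _)
  rw [abs_le] at h
  unfold randomizedResponse
  constructor <;> gcongr <;> linarith

theorem sum_randomizedResponse_mul {θ : ℝ} (hθ : 0 < θ) (a : ι → ℝ) (h : ι → ℝ) [Nonempty ι] :
    ∑ m, randomizedResponse θ a m * (Fintype.card ι / θ * bitSign m.2 * h m.1) =
      ∑ i, h i * a i := by
  rw [Fintype.sum_prod_type]
  refine Finset.sum_congr rfl fun i _ => ?_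
  have : (Fintype.card ι : ℝ) ≠ 0 := by exact_mod_cast Fintype.card_ne_zero
  simp only [Fintype.sum_bool, randomizedResponse, bitSign]
  simp only [if_true, Bool.false_eq_true, if_false]
  field_simp
  ring

/-- The square removes the sign, so the private input `a` cancels and only the uniform choice of
coordinate remains. -/
theorem sum_randomizedResponse_mul_sq (θ : ℝ) (a : ι → ℝ) (h : ι → ℝ) [Nonempty ι] :
    ∑ m, randomizedResponse θ a m * (Fintype.card ι / θ * bitSign m.2 * h m.1) ^ 2 =
      Fintype.card ι / θ ^ 2 * ∑ i, h i ^ 2 := by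
  rw [Fintype.sum_prod_type, Finset.mul_sum]
  refine Finset.sum_congr rfl fun i _ => ?_
  have : (Fintype.card ι : ℝ) ≠ 0 := by exact_mod_cast Fintype.card_ne_zero
  simp only [Fintype.sum_bool, randomizedResponse, bitSign]
  simp only [if_true, Bool.false_eq_true, if_false]
  field_simp
  ring

theorem sum_randomizedResponse (θ : ℝ) (a : ι → ℝ) [Nonempty ι] :
    ∑ m, randomizedResponse θ a m = 1 := by
  have : (Fintype.card ι : ℝ) ≠ 0 := by exact_mod_cast Fintype.card_ne_zero
  rw [Fintype.sum_prod_type]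
  have : ∀ i, ∑ b, randomizedResponse θ a (i, b) = 1 / Fintype.card ι := fun i => by
    simp only [Fintype.sum_bool, randomizedResponse, bitSign]
    simp only [if_true, Bool.false_eq_true, if_false]
    field_simp
    ring
  simp only [this, Finset.sum_const, Finset.card_univ, nsmul_eq_mul]
  field_simp

variable [DecidableEq ι] [DecidableEq E]

/-- The unbiased estimate of the vector `a (·, e)` from a message of `randomizedResponse θ a`. -/
def decodeBlock (θ : ℝ) (e : E) (m : (ι × E) × Bool) (s : ι) : ℝ :=
  Fintype.card (ι × E) / θ * bitSign m.2 * if m.1 = (s, e) then 1 else 0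

theorem sum_mul_decodeBlock (θ : ℝ) (e : E) (m : (ι × E) × Bool) (w : ι → ℝ) :
    ∑ s, w s * decodeBlock θ e m s = Fintype.card (ι × E) / θ * bitSign m.2 *
      if m.1.2 = e then w m.1.1 else 0 := by
  obtain ⟨⟨i, e'⟩, b⟩ := m
  unfold decodeBlock
  by_cases h : e' = e
  · subst h
    have : ∀ s, w s * (Fintype.card (ι × E) / θ * bitSign b * if (i, e') = (s, e') then 1 else 0) =
        if i = s then Fintype.card (ι × E) / θ * bitSign b * w s else 0 := fun s => by
      by_cases h : i = s <;> simp [h]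
      ring
    simp only [this, Finset.sum_ite_eq, Finset.mem_univ, if_true]
  · simp [h]

theorem sum_randomizedResponse_mul_decodeBlock {θ : ℝ} (hθ : 0 < θ) (a : ι × E → ℝ) (e : E)
    (s : ι) : ∑ m, randomizedResponse θ a m * decodeBlock θ e m s = a (s, e) := by
  have : Nonempty (ι × E) := ⟨(s, e)⟩
  have h := sum_randomizedResponse_mul hθ a fun i => if i = (s, e) then 1 else 0
  simpa [decodeBlock] using h

/-- A message decodes to a vector with at most one nonzero entry, at a uniformly random place. Its
second moment is therefore the same in all unit directions, smaller by the factor `card ι` than its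
mean squared norm. -/
theorem sum_randomizedResponse_mul_sq_decodeBlock (θ : ℝ) (a : ι × E → ℝ) (e : E) (w : ι → ℝ)
    [Nonempty ι] :
    ∑ m, randomizedResponse θ a m * (∑ s, w s * decodeBlock θ e m s) ^ 2 =
      Fintype.card (ι × E) / θ ^ 2 * ∑ s, w s ^ 2 := by
  have : Nonempty (ι × E) := ⟨(Classical.arbitrary ι, e)⟩
  simp only [sum_mul_decodeBlock]
  rw [sum_randomizedResponse_mul_sq θ a fun i : ι × E => if i.2 = e then w i.1 else 0,
    Fintype.sum_prod_type]
  simp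

end RandomizedResponse

/-! ### The private estimator for factorized kernels -/

theorem card_sq_le_four_mul_choose_two {n : ℕ} (hn : 2 ≤ n) :
    (n : ℝ) ^ 2 ≤ 4 * (n.choose 2 : ℝ) := by
  rw [Nat.cast_choose_two]
  have : (2 : ℝ) ≤ n := by exact_mod_cast hn
  nlinarith

/-- Private simultaneous estimation of two pairwise statistics with factorized kernels. -/
theorem exists_pairwise_estimators {ε₀ : ℝ} (hε₀ : 0 < ε₀) : ∃ C : ℝ, 0 < C ∧
    ∀ (n : ℕ) (ε : ℝ) (T : Type) [Fintype T], 2 ≤ n → 0 < ε → ε ≤ ε₀ → 2 ≤ Fintype.card T →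
    ∀ (γ : Bool → ℝ) (f : Bool → T → T → ℝ), (∀ j, HasBoundedFactorization (γ j) (f j)) →
    ∃ (Ω : Type) (_ : Fintype Ω) (p : T → Ω → ℝ) (g : Bool → (Fin n → Ω) → ℝ),
      (∀ x a, 0 ≤ p x a) ∧ (∀ x, ∑ a, p x a = 1) ∧
      (∀ x y a, p x a ≤ Real.exp ε * p y a) ∧
      ∀ (x : Fin n → T) (j : Bool),
        piExp (fun i => p (x i)) (fun m => (g j m - pairwiseStatistic (f j) x) ^ 2) ≤
          C * (γ j ^ 2 * Real.log (Fintype.card T) / (ε ^ 2 * n)) := by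
  set K := 2 + ε₀ with hK
  have hK1 : 1 ≤ K := by linarith
  refine ⟨2304 * K ^ 4 + 54, by positivity, fun n ε T _ hn hε hεε₀ hT γ f hf => ?_⟩
  have hn0 : (0 : ℝ) < n := by exact_mod_cast (by omega : 0 < n)
  have hk2 : (2 : ℝ) ≤ Fintype.card T := by exact_mod_cast hT
  have hlog : 1 / 2 ≤ Real.log (Fintype.card T) := by
    have := Real.log_le_log two_pos hk2
    linarith [Real.log_two_gt_d9]
  have hc := card_sq_le_four_mul_choose_two hn
  have hc0 : (0 : ℝ) < n.choose 2 := by exact_mod_cast Nat.choose_pos hn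
  set N := ε ^ 2 * n with hN
  have hN0 : 0 < N := by positivity
  have hK4 : 1 ≤ K ^ 4 := one_le_pow₀ hK1
  -- If `ε² n < 1` the target bound exceeds a multiple of `γ²`, and the constant estimate `0`
  -- suffices.
  rcases lt_or_ge N 1 with hN1 | hN1
  · refine ⟨Unit, inferInstance, fun _ _ => 1, fun _ _ => 0, by simp, by simp,
      fun _ _ _ => by simpa using hε.le, fun x j => ?_⟩
    rw [piExp_const (by simp)]
    have h1 := abs_pairwiseStatistic_le (f := f j) x hn fun i j' => (hf j).abs_le _ _
    have h2 := sq_le_sq' (abs_le.1 h1).1 (abs_le.1 h1).2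
    rw [zero_sub, neg_sq, ← mul_div_assoc, le_div_iff₀ hN0]
    have h3 := sq_nonneg (γ j)
    have h4 : pairwiseStatistic (f j) x ^ 2 * N ≤ γ j ^ 2 * 1 :=
      mul_le_mul h2 hN1.le hN0.le h3
    have h5 : γ j ^ 2 * 1 ≤ γ j ^ 2 * (2 * Real.log (Fintype.card T)) := by gcongr; linarith
    have h6 : 0 ≤ γ j ^ 2 * Real.log (Fintype.card T) := by positivity
    nlinarith
  -- The number of retained terms balances the approximation error `γ² log k / d` against the
  -- variance term of order `γ² d / N²`.
  set d := ⌈N⌉₊ with hd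
  have hd0 : 0 < d := Nat.ceil_pos.2 hN0
  have hdN : N ≤ d := Nat.le_ceil N
  have hdN' : (d : ℝ) ≤ 2 * N := by
    have := Nat.ceil_lt_add_one hN0.le
    linarith
  have hd' : (0 : ℝ) < d := by exact_mod_cast hd0
  choose a b ha hb hab using fun j => (hf j).exists_approx hT hd0
  set θ := ε / K with hθ
  have hθ0 : 0 < θ := by positivity
  have hθ1 : 0 < 1 - θ := by
    rw [hθ, sub_pos, div_lt_one (by positivity)]
    linarith
  -- The likelihood ratio of a message is at most `(1 + θ) / (1 - θ)`. It is at most `1 + ε ≤ exp ε`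
  -- as soon as `θ (2 + ε) ≤ ε`, hence `K = 2 + ε₀`.
  have hθε : 1 + θ ≤ Real.exp ε * (1 - θ) := by
    have h1 : (1 + ε) * (1 - θ) ≤ Real.exp ε * (1 - θ) :=
      mul_le_mul_of_nonneg_right (by linarith [Real.add_one_le_exp ε]) hθ1.le
    have h2 : θ * K = ε := div_mul_cancel₀ _ (by positivity)
    have h3 : θ * (2 + ε) ≤ θ * K := mul_le_mul_of_nonneg_left (by linarith) hθ0.le
    linarith
  -- A user's vector concatenates four blocks of length `d`: left and right factors for each of the
  -- two kernels.
  set v : T → Fin d × Bool × Bool → ℝ := fun x i =>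
    if i.2.2 then a i.2.1 i.1 x else b i.2.1 i.1 x with hv
  have hv1 : ∀ x i, |v x i| ≤ 1 := fun x i => by
    simp only [hv]
    split_ifs
    · exact ha _ _ _
    · exact hb _ _ _
  have : Nonempty (Fin d) := ⟨⟨0, hd0⟩⟩
  have hp0 : ∀ x m, 0 ≤ randomizedResponse θ (v x) m := fun x m =>
    (div_nonneg hθ1.le (by positivity)).trans (randomizedResponse_bounds hθ0.le (hv1 x) m).1
  have hcard : (Fintype.card (Fin d × Bool × Bool) : ℝ) = 4 * d := by
    simp
    ring
  refine ⟨(Fin d × Bool × Bool) × Bool, inferInstance, fun x => randomizedResponse θ (v x),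
    fun j m => γ j / d * pairwiseStatistic (fun m m' =>
      ∑ s, decodeBlock θ (j, true) m s * decodeBlock θ (j, false) m' s) m,
    hp0, fun x => sum_randomizedResponse θ _, fun x y m => ?_, fun x j => ?_⟩
  · refine (randomizedResponse_bounds hθ0.le (hv1 x) m).2.trans ?_
    refine le_trans ?_ (mul_le_mul_of_nonneg_left
      (randomizedResponse_bounds hθ0.le (hv1 y) m).1 (Real.exp_pos _).le)
    rw [← mul_div_assoc]
    gcongr
  have hV : ∀ i e (w : Fin d → ℝ), ∑ m, randomizedResponse θ (v (x i)) m *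
      (∑ s, w s * decodeBlock θ e m s) ^ 2 ≤ (4 * d / θ ^ 2) * ∑ s, w s ^ 2 := fun i e w => by
    rw [sum_randomizedResponse_mul_sq_decodeBlock, hcard]
  have hD : ∀ i e, ∑ s, (∑ m, randomizedResponse θ (v (x i)) m * decodeBlock θ e m s) ^ 2 ≤
      (d : ℝ) := fun i e => by
    simp only [sum_randomizedResponse_mul_decodeBlock hθ0]
    calc ∑ s, v (x i) (s, e) ^ 2 ≤ ∑ _s : Fin d, (1 : ℝ) :=
          Finset.sum_le_sum fun s _ => (sq_le_one_iff_abs_le_one _).2 (hv1 _ _)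
      _ = d := by simp
  have hvar := piExp_sq_pairSum_sub_le (decodeBlock θ (j, true)) (decodeBlock θ (j, false))
    (by positivity) hd'.le (p := fun i => randomizedResponse θ (v (x i))) (fun i => hp0 _)
    (fun i => sum_randomizedResponse θ _) (fun i => hV i _) (fun i => hV i _) (fun i => hD i _)
    (fun i => hD i _)
  have hmean : pairSum (fun P Q => ∑ s, (∑ a, P a * decodeBlock θ (j, true) a s) *
      (∑ a, Q a * decodeBlock θ (j, false) a s)) (fun i => randomizedResponse θ (v (x i))) =
      pairSum (fun x y => ∑ s, a j s x * b j s y) x := by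
    simp only [pairSum, sum_randomizedResponse_mul_decodeBlock hθ0, hv, if_true,
      Bool.false_eq_true, if_false]
  rw [hmean, Fintype.card_fin] at hvar
  set S := pairSum (fun x y => ∑ s, a j s x * b j s y) x with hS
  -- `A` is the deterministic bias from sparsification.
  set A := pairwiseStatistic (fun x y => γ j / d * ∑ s, a j s x * b j s y - f j x y) x with hA
  have hA2 : A ^ 2 ≤ 27 * (γ j ^ 2 * Real.log (Fintype.card T) / d) := by
    have := abs_pairwiseStatistic_le
      (f := fun x y => γ j / d * ∑ s, a j s x * b j s y - f j x y) x hn fun i i' => Real.abs_le_sqrt (hab j (x i) (x i'))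
    rw [← sq_abs, ← Real.sq_sqrt (by positivity :
      0 ≤ 27 * (γ j ^ 2 * Real.log (Fintype.card T) / d))]
    exact pow_le_pow_left₀ (abs_nonneg _) this 2
  have hpt : ∀ m : Fin n → (Fin d × Bool × Bool) × Bool, (γ j / d * pairwiseStatistic (fun m m' =>
      ∑ s, decodeBlock θ (j, true) m s * decodeBlock θ (j, false) m' s) m -
      pairwiseStatistic (f j) x) ^ 2 ≤ 2 * (γ j / (d * n.choose 2)) ^ 2 * (pairSum (fun m m' =>
      ∑ s, decodeBlock θ (j, true) m s * decodeBlock θ (j, false) m' s) m - S) ^ 2 +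
      2 * A ^ 2 := by
    intro m
    have e : γ j / d * pairwiseStatistic (fun m m' =>
      ∑ s, decodeBlock θ (j, true) m s * decodeBlock θ (j, false) m' s) m -
      pairwiseStatistic (f j) x = γ j / (d * n.choose 2) * (pairSum (fun m m' =>
      ∑ s, decodeBlock θ (j, true) m s * decodeBlock θ (j, false) m' s) m - S) + A := by
      rw [hA, pairwiseStatistic_sub]
      simp only [pairwiseStatistic, pairSum_const_mul, ← hS]
      field_simp
      ring
    rw [e]
    refine add_sq_le.trans (le_of_eq ?_)
    ring
  refine (piExp_mono (fun i => hp0 _) hpt).trans ?_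
  rw [piExp_add, piExp_const_mul, piExp_const fun i => sum_randomizedResponse θ _]
  -- The variance bound with `V = 4d / θ²` and `D = d`. Here `(n² / (n choose 2))² ≤ 16` and `d ≤
  -- 2N`, so the constant is `2 * 16 * (4 + 32) = 1152`.
  have h1 : 2 * (γ j / (d * n.choose 2)) ^ 2 * (n ^ 3 * (4 * d / θ ^ 2 * d) +
      n ^ 2 * ((4 * d / θ ^ 2) ^ 2 * d)) ≤ 1152 * K ^ 4 * (γ j ^ 2 / N) := by
    have e1 : 2 * (γ j / (d * n.choose 2)) ^ 2 * (n ^ 3 * (4 * d / θ ^ 2 * d) +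
        n ^ 2 * ((4 * d / θ ^ 2) ^ 2 * d)) =
        2 * γ j ^ 2 * (n ^ 2) ^ 2 / (n.choose 2) ^ 2 *
          (4 * K ^ 2 / N + 16 * d * K ^ 4 / N ^ 2) := by
      rw [hθ, hN]
      field_simp
      ring
    have h2 : ((n : ℝ) ^ 2) ^ 2 / (n.choose 2 : ℝ) ^ 2 ≤ 16 := by
      rw [div_le_iff₀ (by positivity)]
      have := pow_le_pow_left₀ (by positivity) hc 2
      linarith
    have h3 : 4 * K ^ 2 / N + 16 * d * K ^ 4 / N ^ 2 ≤ 36 * K ^ 4 / N := by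
      have h4 : 16 * d * K ^ 4 / N ^ 2 ≤ 16 * (2 * N) * K ^ 4 / N ^ 2 := by gcongr
      have h5 : 16 * (2 * N) * K ^ 4 / N ^ 2 = 32 * K ^ 4 / N := by
        field_simp
        ring
      have h6 : 4 * K ^ 2 / N ≤ 4 * K ^ 4 / N := by
        gcongr
        · norm_num
      have h7 : 4 * K ^ 4 / N + 32 * K ^ 4 / N = 36 * K ^ 4 / N := by ring
      linarith
    rw [e1]
    calc _ = 2 * γ j ^ 2 * ((n ^ 2) ^ 2 / (n.choose 2) ^ 2) *
          (4 * K ^ 2 / N + 16 * d * K ^ 4 / N ^ 2) := by ring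
      _ ≤ 2 * γ j ^ 2 * 16 * (36 * K ^ 4 / N) := by gcongr
      _ = _ := by ring
  have h2 : 2 * (γ j / (d * n.choose 2)) ^ 2 * piExp (fun i => randomizedResponse θ (v (x i)))
      (fun m => (pairSum (fun m m' => ∑ s, decodeBlock θ (j, true) m s *
        decodeBlock θ (j, false) m' s) m - S) ^ 2) ≤ 1152 * K ^ 4 * (γ j ^ 2 / N) :=
    (mul_le_mul_of_nonneg_left hvar (by positivity)).trans h1
  have h3 : γ j ^ 2 / N ≤ 2 * (γ j ^ 2 * Real.log (Fintype.card T) / N) := by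
    rw [← mul_div_assoc]
    gcongr
    nlinarith [sq_nonneg (γ j)]
  have h4 : γ j ^ 2 * Real.log (Fintype.card T) / d ≤
      γ j ^ 2 * Real.log (Fintype.card T) / N := by gcongr
  have h5 : 1152 * K ^ 4 * (γ j ^ 2 / N) ≤
      1152 * K ^ 4 * (2 * (γ j ^ 2 * Real.log (Fintype.card T) / N)) := by gcongr
  linarith

/-! ### From finite message weights to mechanisms -/

section FiniteMechanism

variable {𝒳 Ω : Type} [Fintype Ω] {n : ℕ}

/-- The mechanism with a finite message space given by the weights `p x` of the messages. -/
theorem exists_mechanism_mse_eq {ε : ℝ} {p : 𝒳 → Ω → ℝ} (hp0 : ∀ x a, 0 ≤ p x a)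
    (hp1 : ∀ x, ∑ a, p x a = 1) (hε : ∀ x y a, p x a ≤ Real.exp ε * p y a)
    (g : (Fin n → Ω) → ℝ) :
    ∃ M : NonInteractiveMechanism 𝒳 n, M.IsLocalDP ε ∧ ∀ x z,
      M.mse x z = ENNReal.ofReal (piExp (fun i => p (x i)) fun m => (g m - z) ^ 2) := by
  classical
  let _ : MeasurableSpace Ω := ⊤
  have : MeasurableSingletonClass Ω := ⟨fun _ => trivial⟩
  have h1 : ∀ x, ∑ a, ENNReal.ofReal (p x a) = 1 := fun x => by
    rw [← ENNReal.ofReal_sum_of_nonneg fun a _ => hp0 x a, hp1, ENNReal.ofReal_one]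
  refine ⟨{ Msg := Ω
            randomizer := fun x => (PMF.ofFintype (fun a => ENNReal.ofReal (p x a)) (h1 x)).toMeasure
            isProbabilityMeasure_randomizer := fun x => inferInstance
            estimator := g
            measurable_estimator := measurable_of_countable g }, ?_, fun x z => ?_⟩
  · intro x x' S hS
    dsimp only
    rw [PMF.toMeasure_apply_fintype _ S, PMF.toMeasure_apply_fintype _ S,
      Finset.mul_sum]
    refine Finset.sum_le_sum fun a _ => ?_
    by_cases h : a ∈ S
    · simp only [Set.indicator_of_mem h, PMF.ofFintype_apply]
      rw [← ENNReal.ofReal_mul (Real.exp_pos _).le]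
      exact ENNReal.ofReal_le_ofReal (hε x x' a)
    · simp [Set.indicator_of_notMem h]
  · unfold NonInteractiveMechanism.mse NonInteractiveMechanism.transcript piExp
    rw [lintegral_fintype, ENNReal.ofReal_sum_of_nonneg fun m _ =>
      mul_nonneg (Finset.prod_nonneg fun i _ => hp0 _ _) (sq_nonneg _)]
    refine Finset.sum_congr rfl fun m _ => ?_
    rw [Measure.pi_singleton, mul_comm,
      ENNReal.ofReal_mul (Finset.prod_nonneg fun i _ => hp0 _ _),
      ENNReal.ofReal_prod_of_nonneg fun i _ => hp0 _ _]
    simp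

/-- With at most one possible input, `log k = 0` and the bound demands zero error; there is at most
one data set, so a constant estimate is exact. -/
theorem exists_mechanism_of_subsingleton [Subsingleton 𝒳] {ε : ℝ} (hε : 0 < ε)
    (F : (Fin n → 𝒳) → ℝ) : ∃ M : NonInteractiveMechanism 𝒳 n, M.IsLocalDP ε ∧
      ∀ x, M.mse x (F x) = 0 := by
  classical
  obtain ⟨M, hM, h⟩ := exists_mechanism_mse_eq (𝒳 := 𝒳) (n := n) (Ω := Unit) (ε := ε)
    (p := fun _ _ => 1) (by simp) (by simp) (fun _ _ _ => by simpa using hε.le)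
    (fun _ => if h : Nonempty (Fin n → 𝒳) then F h.some else 0)
  refine ⟨M, hM, fun x => ?_⟩
  have hx : Nonempty (Fin n → 𝒳) := ⟨x⟩
  rw [h, piExp_const (by simp), dif_pos hx, Subsingleton.elim hx.some x]
  simp

end FiniteMechanism

/-! ### AUC as a ratio of two pairwise statistics -/

theorem sum_sum_eq_sum_lt {n : ℕ} {F : Fin n → Fin n → ℝ} (hF : ∀ i, F i i = 0) :
    ∑ i, ∑ j, F i j = ∑ i, ∑ j ∈ Finset.univ.filter (i < ·), (F i j + F j i) := by
  have hsplit : ∀ i j, F i j = (if i < j then F i j else 0) + if j < i then F i j else 0 := by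
    intro i j
    rcases lt_trichotomy i j with h | rfl | h
    · rw [if_pos h, if_neg h.not_gt, add_zero]
    · rw [if_neg (lt_irrefl _), hF, add_zero]
    · rw [if_pos h, if_neg h.not_gt, zero_add]
  rw [Finset.sum_congr rfl fun i _ => Finset.sum_congr rfl fun j _ => hsplit i j]
  simp only [Finset.sum_add_distrib, Finset.sum_filter]
  congr 1
  exact Finset.sum_comm

/-- The normalization of AUC depends on private labels; written as a pair sum it can be estimated
like the numerator. -/
theorem pairSum_label_eq {n : ℕ} {y : Fin n → ℝ × ℝ} (hy : ∀ i, (y i).2 = 0 ∨ (y i).2 = 1) :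
    pairSum (fun a b : ℝ × ℝ => if a.2 ≠ b.2 then (1 : ℝ) else 0) y =
      labelCount y 1 * labelCount y 0 := by
  have hcount : ∀ b, (labelCount y b : ℝ) = ∑ i, if (y i).2 = b then (1 : ℝ) else 0 := fun b => by
    simp [labelCount]
  rw [hcount, hcount, Finset.sum_mul_sum, sum_sum_eq_sum_lt fun i => by
    rcases hy i with h | h <;> simp [h]]
  refine Finset.sum_congr rfl fun i _ => Finset.sum_congr rfl fun j _ => ?_
  rcases hy i with h | h <;> rcases hy j with h' | h' <;> simp [h, h']

/-- Makes the numerator of AUC at most its denominator, as the ratio estimate requires. -/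
theorem abs_kendallKernel_le (a b : ℝ × ℝ) :
    |kendallKernel a b| ≤ if a.2 ≠ b.2 then (1 : ℝ) else 0 := by
  have hs : ∀ t : ℝ, |Real.sign t| ≤ 1 := fun t => by
    rcases Real.sign_apply_eq t with h | h | h <;> rw [h] <;> simp
  unfold kendallKernel
  split_ifs with h
  · rw [abs_mul]
    exact mul_le_one₀ (hs _) (abs_nonneg _) (hs _)
  · simp [not_not.1 h]

/-- Ratio estimation with the denominator clamped at a known lower bound `q`. -/
theorem sq_div_max_sub_div_le {q P Q P' Q' : ℝ} (hq : 0 < q) (hQ : q ≤ Q) (hP : |P| ≤ Q) :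
    (P' / max Q' q - P / Q) ^ 2 ≤ 2 / q ^ 2 * ((P' - P) ^ 2 + (Q' - Q) ^ 2) := by
  have hQ0 : 0 < Q := hq.trans_le hQ
  set R := max Q' q with hR
  have hRq : q ≤ R := le_max_right _ _
  have hR0 : 0 < R := hq.trans_le hRq
  have hRQ : |R - Q| ≤ |Q' - Q| := by
    have := abs_max_sub_max_le_abs Q' Q q
    rwa [max_eq_left hQ] at this
  have hPQ : |P / Q| ≤ 1 := by
    rw [abs_div, abs_of_pos hQ0, div_le_one hQ0]
    exact hP
  have e : P' / R - P / Q = ((P' - P) - P / Q * (R - Q)) / R := by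
    field_simp
    ring
  have h1 : (P / Q * (R - Q)) ^ 2 ≤ (Q' - Q) ^ 2 := by
    rw [← sq_abs, ← sq_abs (Q' - Q), abs_mul]
    refine pow_le_pow_left₀ (by positivity) ?_ 2
    exact (mul_le_of_le_one_left (abs_nonneg _) hPQ).trans hRQ
  have h2 : ((P' - P) - P / Q * (R - Q)) ^ 2 ≤ 2 * ((P' - P) ^ 2 + (Q' - Q) ^ 2) := by
    nlinarith [sq_nonneg ((P' - P) + P / Q * (R - Q))]
  rw [e, div_pow]
  calc _ ≤ 2 * ((P' - P) ^ 2 + (Q' - Q) ^ 2) / q ^ 2 := by gcongr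
    _ = _ := by ring

theorem pairwise_mse_of_finite {ε₀ : ℝ} (hε₀ : 0 < ε₀) : ∃ C : ℝ, 0 < C ∧
    ∀ (n : ℕ) (ε : ℝ) (T : Type) [Fintype T], 2 ≤ n → 0 < ε → ε ≤ ε₀ →
    ∀ (γ : ℝ) (f : T → T → ℝ), HasBoundedFactorization γ f →
    ∃ M : NonInteractiveMechanism T n, M.IsLocalDP ε ∧ ∀ x : Fin n → T,
      M.mse x (pairwiseStatistic f x) ≤
        ENNReal.ofReal (C * (γ ^ 2 * Real.log (Fintype.card T) / (ε ^ 2 * n))) := by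
  obtain ⟨C, hC, h⟩ := exists_pairwise_estimators hε₀
  refine ⟨C, hC, fun n ε T _ hn hε hεε₀ γ f hf => ?_⟩
  rcases Nat.lt_or_ge (Fintype.card T) 2 with hT | hT
  · have : Subsingleton T := Fintype.card_le_one_iff_subsingleton.1 (by omega)
    obtain ⟨M, hM, h0⟩ := exists_mechanism_of_subsingleton (n := n) hε
      fun x : Fin n → T => pairwiseStatistic f x
    exact ⟨M, hM, fun x => by rw [h0]; exact zero_le⟩
  · obtain ⟨Ω, _, p, g, hp0, hp1, hp, hg⟩ :=
      h n ε T hn hε hεε₀ hT (fun _ => γ) (fun _ => f) fun _ => hf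
    obtain ⟨M, hM, h0⟩ := exists_mechanism_mse_eq hp0 hp1 hp (g true)
    exact ⟨M, hM, fun x => by rw [h0]; exact ENNReal.ofReal_le_ofReal (hg x true)⟩

theorem auc_mse {ε₀ : ℝ} (hε₀ : 0 < ε₀) {c : ℝ} (hc : 0 < c) : ∃ C : ℝ, 0 < C ∧
    ∀ (n : ℕ) (ε : ℝ) (A : Finset ℝ), 2 ≤ n → 0 < ε → ε ≤ ε₀ →
      ∃ M : NonInteractiveMechanism ↥(A ×ˢ ({0, 1} : Finset ℝ)) n, M.IsLocalDP ε ∧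
        ∀ x : Fin n → ↥(A ×ˢ ({0, 1} : Finset ℝ)),
          c * n ≤ labelCount (fun i => (x i : ℝ × ℝ)) 0 →
          c * n ≤ labelCount (fun i => (x i : ℝ × ℝ)) 1 →
          M.mse x (aucStatistic fun i => (x i : ℝ × ℝ)) ≤
            ENNReal.ofReal
              (C * (Real.log ((A ×ˢ ({0, 1} : Finset ℝ)).card) ^ 3 / (ε ^ 2 * n))) := by
  obtain ⟨C, hC, h⟩ := exists_pairwise_estimators hε₀
  -- Balancedness gives `n⁺ n⁻ / (n choose 2) ≥ 2 c² n² / (n (n - 1)) ≥ 2 c²`.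
  set q := 2 * c ^ 2 with hq
  have hq0 : 0 < q := by positivity
  refine ⟨2 / q ^ 2 * (C * 1296 + C * 16), by positivity, fun n ε A hn hε hεε₀ => ?_⟩
  set T := ↥(A ×ˢ ({0, 1} : Finset ℝ)) with hTdef
  have hcardB : ({0, 1} : Finset ℝ).card = 2 := Finset.card_pair zero_ne_one
  have hcardT : Fintype.card T = (A ×ˢ ({0, 1} : Finset ℝ)).card := Fintype.card_coe _
  rcases Nat.lt_or_ge (Fintype.card T) 2 with hT | hT
  · have : Subsingleton T := Fintype.card_le_one_iff_subsingleton.1 (by omega)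
    obtain ⟨M, hM, h0⟩ := exists_mechanism_of_subsingleton (n := n) hε
      fun x : Fin n → T => aucStatistic fun i => (x i : ℝ × ℝ)
    exact ⟨M, hM, fun x _ _ => by rw [h0]; exact zero_le⟩
  have hA : 0 < A.card := by
    rw [hcardT, Finset.card_product, hcardB] at hT
    omega
  have hlogA : Real.log A.card ≤ Real.log (Fintype.card T) := by
    refine Real.log_le_log (by exact_mod_cast hA) ?_
    rw [hcardT, Finset.card_product, hcardB]
    exact_mod_cast (by omega : A.card ≤ A.card * 2)
  have hlogA0 : 0 ≤ Real.log A.card := Real.log_natCast_nonneg _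
  have hlog : 1 / 2 ≤ Real.log (Fintype.card T) := by
    have := Real.log_le_log two_pos (by exact_mod_cast hT : (2 : ℝ) ≤ Fintype.card T)
    linarith [Real.log_two_gt_d9]
  rw [← hcardT]
  set ℓ := Real.log (Fintype.card T) with hℓ
  have hx2 : ∀ x : T, (x : ℝ × ℝ).2 = 0 ∨ (x : ℝ × ℝ).2 = 1 := fun x => by
    simpa using (Finset.mem_product.1 x.2).2
  have f1 : HasBoundedFactorization (36 * ℓ) fun x y : T => kendallKernel (x : ℝ × ℝ) y := by
    refine (HasBoundedFactorization.kendallKernel A {0, 1}).mono ?_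
    rw [hcardB]
    have h1 : Real.log ((2 : ℕ) : ℝ) ≤ 1 := by
      push_cast
      linarith [Real.log_two_lt_d9]
    have h2 := mul_le_mul_of_nonneg_left h1 hlogA0
    linarith
  have f2 : HasBoundedFactorization 2 fun x y : T =>
      if (x : ℝ × ℝ).2 ≠ (y : ℝ × ℝ).2 then (1 : ℝ) else 0 := by
    have := HasBoundedFactorization.neKernel fun x : T =>
      (⟨(x : ℝ × ℝ).2, (Finset.mem_product.1 x.2).2⟩ : ({0, 1} : Finset ℝ))
    simpa using this
  -- Each user sends only one message, so numerator and denominator are estimated from the same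
  -- transcript.
  obtain ⟨Ω, _, p, g, hp0, hp1, hp, hg⟩ := h n ε T hn hε hεε₀ hT
    (fun j => cond j (36 * ℓ) 2) (fun j => cond j (fun x y : T => kendallKernel (x : ℝ × ℝ) y)
      fun x y : T => if (x : ℝ × ℝ).2 ≠ (y : ℝ × ℝ).2 then (1 : ℝ) else 0)
    (by rintro (_ | _); exacts [f2, f1])
  obtain ⟨M, hM, h0⟩ := exists_mechanism_mse_eq hp0 hp1 hp fun m => g true m / max (g false m) q
  refine ⟨M, hM, fun x hn0 hn1 => ?_⟩
  rw [h0]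
  refine ENNReal.ofReal_le_ofReal ?_
  set P := pairwiseStatistic (fun x y : T => kendallKernel (x : ℝ × ℝ) y) x with hPdef
  set Q := pairwiseStatistic
    (fun x y : T => if (x : ℝ × ℝ).2 ≠ (y : ℝ × ℝ).2 then (1 : ℝ) else 0) x with hQdef
  have g1 : piExp (fun i => p (x i)) (fun m => (g true m - P) ^ 2) ≤
      C * ((36 * ℓ) ^ 2 * ℓ / (ε ^ 2 * n)) := hg x true
  have g2 : piExp (fun i => p (x i)) (fun m => (g false m - Q) ^ 2) ≤
      C * (2 ^ 2 * ℓ / (ε ^ 2 * n)) := hg x false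
  have hch : (0 : ℝ) < n.choose 2 := by exact_mod_cast Nat.choose_pos hn
  have hn' : (0 : ℝ) < n := by exact_mod_cast (by omega : 0 < n)
  have hQ : Q = labelCount (fun i => (x i : ℝ × ℝ)) 1 * labelCount (fun i => (x i : ℝ × ℝ)) 0 /
      n.choose 2 := by
    rw [← pairSum_label_eq fun i => hx2 (x i)]
    rfl
  have hqQ : q ≤ Q := by
    rw [hQ, le_div_iff₀ hch, Nat.cast_choose_two, hq]
    have := mul_le_mul hn1 hn0 (by positivity) (by positivity)
    nlinarith [mul_pos (sq_pos_of_pos hc) hn']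
  have hPQ : |P| ≤ Q := by
    rw [hPdef, hQdef, pairwiseStatistic, pairwiseStatistic, abs_div, abs_of_pos hch]
    gcongr
    exact abs_pairSum_le fun i j => abs_kendallKernel_le _ _
  have hauc : aucStatistic (fun i => (x i : ℝ × ℝ)) = P / Q := by
    rw [hQ, hPdef, pairwiseStatistic, div_div_div_cancel_right₀ hch.ne']
    rfl
  rw [hauc]
  refine (piExp_mono (fun i => hp0 _) fun m => sq_div_max_sub_div_le hq0 hqQ hPQ).trans ?_
  rw [piExp_const_mul, piExp_add, mul_assoc]
  refine mul_le_mul_of_nonneg_left ?_ (by positivity)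
  -- `ℓ ≥ 1 / 2` gives `4 ℓ ≤ 16 ℓ³`, so the denominator's error is absorbed by the numerator's
  -- rate.
  have h4 : C * (2 ^ 2 * ℓ / (ε ^ 2 * n)) ≤ C * (16 * ℓ ^ 3 / (ε ^ 2 * n)) := by
    refine mul_le_mul_of_nonneg_left (div_le_div_of_nonneg_right ?_ (by positivity)) hC.le
    nlinarith [mul_nonneg (by linarith : (0 : ℝ) ≤ ℓ) (by nlinarith : 0 ≤ 4 * ℓ ^ 2 - 1)]
  calc _ ≤ C * ((36 * ℓ) ^ 2 * ℓ / (ε ^ 2 * n)) + C * (16 * ℓ ^ 3 / (ε ^ 2 * n)) := by linarith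
    _ = _ := by ring

/-! ### Lipschitz kernels by rounding to a grid -/

theorem lipschitz_mse {ε₀ : ℝ} (hε₀ : 0 < ε₀) : ∃ C : ℝ, 0 < C ∧
    ∀ (n : ℕ) (ε G : ℝ) (f : unitInterval → unitInterval → ℝ),
      2 ≤ n → 0 < ε → ε ≤ ε₀ → IsLipschitzKernel G f →
      ∃ M : NonInteractiveMechanism unitInterval n, M.IsLocalDP ε ∧
        ∀ x : Fin n → unitInterval, M.mse x (pairwiseStatistic f x) ≤
          ENNReal.ofReal (C * (G ^ 2 * Real.log n / (ε ^ 2 * n))) := by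
  obtain ⟨C, hC, h⟩ := exists_pairwise_estimators hε₀
  refine ⟨16 * C + 16 * ε₀ ^ 2, by positivity, fun n ε G f hn hε hεε₀ ⟨hsymm, hlip⟩ => ?_⟩
  have hn2 : (2 : ℝ) ≤ n := by exact_mod_cast hn
  have hn0 : (0 : ℝ) < n := by linarith
  have hG : 0 ≤ G := by
    have := (abs_nonneg _).trans (hlip 1 0 0)
    simpa using this
  have hlog : 1 / 2 ≤ Real.log n := by
    have := Real.log_le_log two_pos hn2
    linarith [Real.log_two_gt_d9]
  set grid : ℕ → unitInterval := fun i => Set.projIcc 0 1 zero_le_one ((i : ℝ) / n) with hgrid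
  have hgridval : ∀ i ≤ n, (grid i : ℝ) = i / n := fun i hi => by
    rw [hgrid]
    simp only
    rw [Set.projIcc_of_mem]
    exact ⟨by positivity, (div_le_one hn0).2 (by exact_mod_cast hi)⟩
  -- Subtracting `f 0 0` bounds the row `i = 0` by `G`; the analyst adds the constant back.
  set F : ℕ → ℕ → ℝ := fun i j => f (grid i) (grid j) - f 0 0 with hFdef
  have hgrid0 : grid 0 = 0 := Subtype.ext (by rw [hgridval 0 (Nat.zero_le _)]; simp)
  have hF : HasBoundedFactorization (2 * G) fun i j : Fin (n + 1) => F i j := by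
    refine HasBoundedFactorization.gridKernel hG (fun j _ => ?_) fun i hi j _ => ?_
    · simp only [hFdef, hgrid0]
      rw [hsymm 0 (grid j)]
      refine (hlip _ _ _).trans (mul_le_of_le_one_right hG ?_)
      have h1 := (grid j).2
      rw [Set.Icc.coe_zero, sub_zero, abs_of_nonneg h1.1]
      exact h1.2
    · simp only [hFdef, sub_sub_sub_cancel_right]
      refine (hlip _ _ _).trans (le_of_eq ?_)
      rw [hgridval _ hi, hgridval _ hi.le, ← sub_div]
      push_cast
      rw [add_sub_cancel_left, abs_of_nonneg (by positivity), mul_one_div]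
  obtain ⟨Ω, _, p, g, hp0, hp1, hp, hg⟩ := h n ε (Fin (n + 1)) hn hε hεε₀
    (by rw [Fintype.card_fin]; omega) (fun _ => 2 * G) (fun _ i j => F i j) fun _ => hF
  have hfloor : ∀ t : unitInterval, ⌊(n : ℝ) * t⌋₊ < n + 1 := fun t => by
    rw [Nat.lt_succ_iff]
    refine Nat.floor_le_of_le ?_
    exact mul_le_of_le_one_right hn0.le t.2.2
  -- Each user rounds its own input down to the grid before randomizing, so privacy is inherited.
  set r : unitInterval → Fin (n + 1) := fun t => ⟨⌊(n : ℝ) * t⌋₊, hfloor t⟩ with hr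
  obtain ⟨M, hM, h0⟩ := exists_mechanism_mse_eq (p := fun t => p (r t)) (fun t => hp0 _)
    (fun t => hp1 _) (fun t t' => hp _ _) fun m => g true m + f 0 0
  refine ⟨M, hM, fun x => ?_⟩
  rw [h0]
  refine ENNReal.ofReal_le_ofReal ?_
  have hg1 := hg (fun i => r (x i)) true
  rw [Fintype.card_fin] at hg1
  set S := pairwiseStatistic (fun i j : Fin (n + 1) => F i j) (fun i => r (x i)) with hS
  have hclose : ∀ t : unitInterval, |(t : ℝ) - grid (r t)| ≤ 1 / n := fun t => by
    have hnt : (0 : ℝ) ≤ n * t := mul_nonneg hn0.le t.2.1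
    have h1 := Nat.floor_le hnt
    have h2 := Nat.lt_floor_add_one ((n : ℝ) * t)
    rw [hgridval _ (Nat.lt_succ_iff.1 (r t).2)]
    simp only [hr]
    have e : (t : ℝ) - (⌊(n : ℝ) * t⌋₊ : ℝ) / n = (n * t - ⌊(n : ℝ) * t⌋₊) / n := by
      field_simp
    rw [e, abs_div, abs_of_pos hn0, abs_of_nonneg (by linarith)]
    gcongr
    linarith
  have hdisc : ∀ s t : unitInterval, |f s t - f (grid (r s)) (grid (r t))| ≤ 2 * G / n := by
    intro s t
    have h1 := (hlip s (grid (r s)) t).trans (mul_le_mul_of_nonneg_left (hclose s) hG)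
    have h2 := (hlip t (grid (r t)) (grid (r s))).trans (mul_le_mul_of_nonneg_left (hclose t) hG)
    rw [hsymm t, hsymm (grid (r t))] at h2
    have h3 := abs_sub_le (f s t) (f (grid (r s)) t) (f (grid (r s)) (grid (r t)))
    have e : 2 * G / n = G * (1 / n) + G * (1 / n) := by ring
    linarith
  have hA : |pairwiseStatistic f x - (S + f 0 0)| ≤ 2 * G / n := by
    have e : pairwiseStatistic f x - (S + f 0 0) = pairwiseStatistic
        (fun s t => f s t - f (grid (r s)) (grid (r t))) x := by
      have e2 : S = pairwiseStatistic (fun s t : unitInterval => f (grid (r s)) (grid (r t))) x -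
          pairwiseStatistic (fun _ _ : unitInterval => f 0 0) x := by
        rw [← pairwiseStatistic_sub]
        rfl
      rw [e2, pairwiseStatistic_const _ _ hn, sub_add_cancel, ← pairwiseStatistic_sub]
    rw [e]
    exact abs_pairwiseStatistic_le x hn fun i j => hdisc _ _
  have hA2 : (pairwiseStatistic f x - (S + f 0 0)) ^ 2 ≤ (2 * G / n) ^ 2 :=
    sq_le_sq' (abs_le.1 hA).1 (abs_le.1 hA).2
  have hpt : ∀ m : Fin n → Ω, (g true m + f 0 0 - pairwiseStatistic f x) ^ 2 ≤
      2 * (g true m - S) ^ 2 + 2 * (2 * G / n) ^ 2 := fun m => by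
    nlinarith [sq_nonneg ((g true m - S) + (pairwiseStatistic f x - (S + f 0 0)))]
  refine (piExp_mono (fun i => hp0 _) hpt).trans ?_
  rw [piExp_add, piExp_const_mul, piExp_const fun i => hp1 _]
  have hlog2 : Real.log ((n + 1 : ℕ) : ℝ) ≤ 2 * Real.log n := by
    rw [show (2 : ℝ) * Real.log n = (2 : ℕ) * Real.log n by norm_num, ← Real.log_pow]
    refine Real.log_le_log (by positivity) ?_
    push_cast
    nlinarith
  have h1 : C * ((2 * G) ^ 2 * Real.log ((n + 1 : ℕ) : ℝ) / (ε ^ 2 * n)) ≤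
      8 * C * (G ^ 2 * Real.log n / (ε ^ 2 * n)) := by
    calc _ ≤ C * ((2 * G) ^ 2 * (2 * Real.log n) / (ε ^ 2 * n)) := by gcongr
      _ = _ := by ring
  -- The squared rounding error is of order `G² / n²`; writing it at rate `1 / (ε² n)` costs `ε² ≤
  -- ε₀²`.
  have h2 : 2 * (2 * G / n) ^ 2 ≤ 16 * ε₀ ^ 2 * (G ^ 2 * Real.log n / (ε ^ 2 * n)) := by
    have e : 2 * (2 * G / n) ^ 2 = 8 * G ^ 2 * ε ^ 2 / n / (ε ^ 2 * n) := by
      field_simp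
      ring
    have h3 : 8 * G ^ 2 * ε ^ 2 / n ≤ 16 * ε₀ ^ 2 * (G ^ 2 * Real.log n) := by
      calc 8 * G ^ 2 * ε ^ 2 / n ≤ 8 * G ^ 2 * ε₀ ^ 2 / 1 := by
            gcongr
            linarith
        _ ≤ 16 * ε₀ ^ 2 * (G ^ 2 * Real.log n) := by
            nlinarith [mul_nonneg (mul_nonneg (sq_nonneg G) (sq_nonneg ε₀)) (sub_nonneg.2 hlog)]
    rw [e, ← mul_div_assoc]
    gcongr
  linarith

end

theorem mainTheorem4 (ε₀ : ℝ) (hε₀ : 0 < ε₀) :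
    -- Lipschitz kernels on the unit interval
    (∃ C : ℝ, 0 < C ∧ ∀ (n : ℕ) (ε G : ℝ) (f : unitInterval → unitInterval → ℝ),
      2 ≤ n → 0 < ε → ε ≤ ε₀ → IsLipschitzKernel G f →
      ∃ M : NonInteractiveMechanism unitInterval n, M.IsLocalDP ε ∧
        ∀ x : Fin n → unitInterval,
          M.mse x (pairwiseStatistic f x) ≤
            ENNReal.ofReal (C * (G ^ 2 * Real.log n / (ε ^ 2 * n)))) ∧
    -- Kendall's coefficient
    (∃ C : ℝ, 0 < C ∧ ∀ (n : ℕ) (ε : ℝ) (A B : Finset ℝ),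
      2 ≤ n → 0 < ε → ε ≤ ε₀ →
      ∃ M : NonInteractiveMechanism ↥(A ×ˢ B) n, M.IsLocalDP ε ∧
        ∀ x : Fin n → ↥(A ×ˢ B),
          M.mse x (pairwiseStatistic kendallKernel fun i => (x i : ℝ × ℝ)) ≤
            ENNReal.ofReal (C * (Real.log ((A ×ˢ B).card) ^ 5 / (ε ^ 2 * n)))) ∧
    -- AUC under the balancedness assumption
    (∀ c : ℝ, 0 < c → ∃ C : ℝ, 0 < C ∧ ∀ (n : ℕ) (ε : ℝ) (A : Finset ℝ),
      2 ≤ n → 0 < ε → ε ≤ ε₀ →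
      ∃ M : NonInteractiveMechanism ↥(A ×ˢ ({0, 1} : Finset ℝ)) n, M.IsLocalDP ε ∧
        ∀ x : Fin n → ↥(A ×ˢ ({0, 1} : Finset ℝ)),
          c * n ≤ labelCount (fun i => (x i : ℝ × ℝ)) 0 →
          c * n ≤ labelCount (fun i => (x i : ℝ × ℝ)) 1 →
          M.mse x (aucStatistic fun i => (x i : ℝ × ℝ)) ≤
            ENNReal.ofReal
              (C * (Real.log ((A ×ˢ ({0, 1} : Finset ℝ)).card) ^ 3 / (ε ^ 2 * n)))) ∧
    -- Gini's diversity index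
    (∃ C : ℝ, 0 < C ∧ ∀ (n : ℕ) (ε : ℝ) (X : Finset ℝ),
      2 ≤ n → 0 < ε → ε ≤ ε₀ →
      ∃ M : NonInteractiveMechanism ↥X n, M.IsLocalDP ε ∧
        ∀ x : Fin n → ↥X,
          M.mse x (pairwiseStatistic giniDiversityKernel fun i => (x i : ℝ)) ≤
            ENNReal.ofReal (C * (Real.log X.card / (ε ^ 2 * n)))) := by
  refine ⟨lipschitz_mse hε₀, ?_, fun c hc => auc_mse hε₀ hc, ?_⟩
  · obtain ⟨C, hC, h⟩ := pairwise_mse_of_finite hε₀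
    refine ⟨1296 * C, by positivity, fun n ε A B hn hε hεε₀ => ?_⟩
    have hlogA0 : 0 ≤ Real.log A.card := Real.log_natCast_nonneg _
    have hlogB0 : 0 ≤ Real.log B.card := Real.log_natCast_nonneg _
    obtain ⟨M, hM, hmse⟩ := h n ε ↥(A ×ˢ B) hn hε hεε₀ _ _
      (HasBoundedFactorization.kendallKernel A B)
    refine ⟨M, hM, fun x => (hmse x).trans (ENNReal.ofReal_le_ofReal ?_)⟩
    rw [Fintype.card_coe]
    -- A data set with at least one user shows that `A` and `B` are nonempty, so that the logarithm
    -- of the product splits.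
    have hAB := (Finset.mem_product.1 (x ⟨0, by omega⟩).2)
    have hA : 0 < A.card := Finset.card_pos.2 ⟨_, hAB.1⟩
    have hB : 0 < B.card := Finset.card_pos.2 ⟨_, hAB.2⟩
    have hlog : Real.log (A ×ˢ B).card = Real.log A.card + Real.log B.card := by
      rw [Finset.card_product, Nat.cast_mul, Real.log_mul (by positivity) (by positivity)]
    have h1 : Real.log A.card * Real.log B.card ≤ Real.log (A ×ˢ B).card ^ 2 := by
      rw [hlog]
      nlinarith
    have h2 : 0 ≤ Real.log (A ×ˢ B).card := Real.log_natCast_nonneg _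
    calc C * ((36 * (Real.log A.card * Real.log B.card)) ^ 2 * Real.log (A ×ˢ B).card /
          (ε ^ 2 * n)) ≤ C * ((36 * Real.log (A ×ˢ B).card ^ 2) ^ 2 *
          Real.log (A ×ˢ B).card / (ε ^ 2 * n)) := by gcongr
      _ = _ := by ring
  · obtain ⟨C, hC, h⟩ := pairwise_mse_of_finite hε₀
    refine ⟨4 * C, by positivity, fun n ε X hn hε hεε₀ => ?_⟩
    obtain ⟨M, hM, hmse⟩ := h n ε X hn hε hεε₀ _ _
      (HasBoundedFactorization.neKernel (id : X → X))
    refine ⟨M, hM, fun x => ?_⟩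
    have e : pairwiseStatistic giniDiversityKernel (fun i => (x i : ℝ)) =
        pairwiseStatistic (fun s t : X => if id s ≠ id t then (1 : ℝ) else 0) x := by
      have h1 : (fun s t : X => if id s ≠ id t then (1 : ℝ) else 0) =
          fun s t : X => giniDiversityKernel s t := by
        ext s t
        by_cases h : s = t
        · simp [giniDiversityKernel, h]
        · have h' : (s : ℝ) ≠ t := fun h' => h (Subtype.ext h')
          simp [giniDiversityKernel, h, h']
      rw [h1]
      rfl
    rw [e]
    refine (hmse x).trans (ENNReal.ofReal_le_ofReal (le_of_eq ?_))
    rw [Fintype.card_coe]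
    ring
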